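/- Let $0<\alpha,\beta,\varepsilon<1$ with $\varepsilon<\alpha+\beta<2-\varepsilon$. Let $\Omega\subset\mathbb R^n$ be a bounded convex domain (for instance polygonal), and let $A=-\Delta$ on $L^2(\Omega)$ with homogeneous Dirichlet boundary condition. Put $$m(z)=\frac{z^{\alpha+\beta}}{z^\alpha+1},\qquad \widehat u(z)=(m(z)I+A)^{-1}\Bigl(\frac{m(z)}{z}u_0+\frac{m(z)}{z^\beta}\widehat f(z)\Bigr),$$ where powers are principal, $u_0\in L^2(\Omega)$ is real-valued and $\widehat f$ is the Laplace transform of a real-valued source $f:(0,\infty)\to L^2(\Omega)$. ($\widehat u$ is the Laplace transform of the solution of ${}_0^CD_t^\beta u+Au+\int_0^t\frac{(t-s)^{\alpha-1}}{\Gamma(\alpha)}Au(s)\,ds=f$, $u(0)=u_0$.) Let $\theta,\tilde c,t_0$ be real with $0<\tilde c<\theta$, $\theta+\tilde c\le\frac{\varepsilon\pi}{2(\alpha+\beta)}$ and $t_0>0$; in particular $\tilde c=\min\{\theta,\frac{\varepsilon\pi}{2(\alpha+\beta)}-\theta\}$ is allowed whenever this number lies strictly between $0$ and $\theta$. Let $\Lambda\ge1$,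 $0<\eta<1$, let $N\ge1$ be an integer, and set $$P(\eta)=\operatorname{arcosh}\Bigl(\frac{\Lambda}{(1-\eta)\sin(\theta-\tilde c)}\Bigr),\qquad \mu=\frac{2\pi\tilde cN(1-\eta)}{\Lambda t_0P(\eta)},\qquad \tau=\frac{P(\eta)}{N}.$$ Let $z(\phi)=\mu(1+\sin(i\phi-\theta))$, let $\Gamma=\{z(\phi):\phi\in\mathbb R\}$, and let $S=\{z(\phi):|\operatorname{Im}\phi|<\tilde c\}$. Suppose that $\widehat f$ is analytic and bounded on $S$ (more precisely, that the Laplace integral, which converges in some right half-plane, extends analytically to a connected open set, symmetric about the real axis, that contains this half-plane and $S$), and let $\|\widehat f\|_S=\sup_{z\in S}\|\widehat f(z)\|_{L^2(\Omega)}$. Define $$u(t)=\frac1{2\pi i}\int_\Gamma e^{zt}\widehat u(z)\,dz,\qquad u^N(t)=\frac\tau\pi\operatorname{Im}\sum_{k=0}^{N-1}e^{z(\phi_k)t}\,\widehat u(z(\phi_k))\,z'(\phi_k),\qquad \phi_k=\bigl(k+\tfrac12\bigr)\tau .$$ Then for every $t\in[t_0,\Lambda t_0]$ the integral defining $u(t)$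 converges absolutely in $L^2(\Omega)$, and $$\|u(t)-u^N(t)\|_{L^2(\Omega)}\le C\,\varphi(\theta,\tilde c)\,L\bigl(\mu t_0\sin(\theta-\tilde c)\bigr)\,\bigl(\|u_0\|_{L^2(\Omega)}+\|\widehat f\|_S\bigr)\,\frac{e^{\mu\Lambda t_0}}{e^{2\pi\tilde c/\tau}-1},$$ where $\varphi(\theta,\tilde c)=\sqrt{\frac{1+\sin(\theta+\tilde c)}{1-\sin(\theta+\tilde c)}}$ and $L(x)=1+|\ln(1-e^{-x})|$. The constant $C>0$ depends only on $\alpha,\beta,\varepsilon,\theta,\tilde c,t_0$; in particular it does not depend on $N,\tau,\mu,\eta,\Lambda,t,u_0,f$ or $\Omega$. If $f=0$, the constant can be chosen to depend only on $\alpha,\beta,\varepsilon$. -/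

import Mathlib

open MeasureTheory Set
open scoped ContDiff ComplexConjugate

noncomputable section

namespace CIM

/-! ## The spatial operator -/

/-- Euclidean space of dimension `n`. -/
abbrev E (n : ℕ) : Type := EuclideanSpace ℝ (Fin n)

/-- The real space `L²(Ω)`. -/
abbrev L2R {n : ℕ} (Ω : Set (E n)) : Type := Lp ℝ 2 (volume.restrict Ω)

/-- The complex space `L²(Ω)`. -/
abbrev L2C {n : ℕ} (Ω : Set (E n)) : Type := Lp ℂ 2 (volume.restrict Ω)

/-- Complex square-integrable vector fields on `Ω`. -/
abbrev L2V {n : ℕ} (Ω : Set (E n)) : Type :=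
  Lp (EuclideanSpace ℂ (Fin n)) 2 (volume.restrict Ω)

/-- A real `L²` function regarded as a complex one. -/
def toC {n : ℕ} {Ω : Set (E n)} (w : L2R Ω) : L2C Ω := Complex.ofRealCLM.compLp w

/-- The imaginary part of a complex `L²` function. -/
def imPart {n : ℕ} {Ω : Set (E n)} (w : L2C Ω) : L2R Ω := Complex.imCLM.compLp w

/-- Complex-valued test functions, the class `C_c^∞(Ω)`. -/
structure IsTest {n : ℕ} (Ω : Set (E n)) (φ : E n → ℂ) : Prop where
  smooth : ContDiff ℝ ∞ φ
  compact : HasCompactSupport φ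
  subset : tsupport φ ⊆ Ω

/-- The gradient of `φ : ℝⁿ → ℂ`. -/
def grad {n : ℕ} (φ : E n → ℂ) (x : E n) : EuclideanSpace ℂ (Fin n) :=
  WithLp.toLp 2 fun i => fderiv ℝ φ x (EuclideanSpace.single i 1)

/-- The complex Sobolev space `H¹₀(Ω)`, as the space of pairs `(w, ∇w)`: the closure in
`L²(Ω) × L²(Ω)ⁿ`, that is, in the `H¹` norm, of the pairs `(φ, ∇φ)` with `φ` a test function.
(The pairs of test functions already form a linear subspace; the span changes nothing.) -/
def H10 {n : ℕ} (Ω : Set (E n)) : Submodule ℂ (WithLp 2 (L2C Ω × L2V Ω)) :=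
  (Submodule.span ℂ {p : WithLp 2 (L2C Ω × L2V Ω) | ∃ φ : E n → ℂ, IsTest Ω φ ∧
    (p.fst : E n → ℂ) =ᵐ[volume.restrict Ω] φ ∧
    (p.snd : E n → EuclideanSpace ℂ (Fin n)) =ᵐ[volume.restrict Ω] grad φ}).topologicalClosure

/-- `IsNegLaplacian Ω w h` means `A w = h`, where `A` is the negative Laplace operator on `L²(Ω)`
with homogeneous Dirichlet boundary condition: `w ∈ H¹₀(Ω)`, and `∫ ∇w · ∇v̄ = ∫ h v̄` for
all `v ∈ H¹₀(Ω)`. -/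
def IsNegLaplacian {n : ℕ} (Ω : Set (E n)) (w h : L2C Ω) : Prop :=
  ∃ p ∈ H10 Ω, p.fst = w ∧ ∀ q ∈ H10 Ω, inner ℂ q.snd p.snd = inner ℂ q.fst h

open Classical in
/-- `(lam I + A)⁻¹ g`: the solution `w` of `A w = g - lam w`. -/
def resolvent {n : ℕ} (Ω : Set (E n)) (lam : ℂ) (g : L2C Ω) : L2C Ω :=
  if h : ∃ w : L2C Ω, IsNegLaplacian Ω w (g - lam • w) then h.choose else 0

/-! ## The Laplace transform of the solution -/

/-- `m(z) = z^(α+β) / (z^α + 1)`, with principal powers. -/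
def mFun (α β : ℝ) (z : ℂ) : ℂ := z ^ ((α + β : ℝ) : ℂ) / (z ^ (α : ℂ) + 1)

/-- `û(z) = (m(z) I + A)⁻¹ ((m(z)/z) u₀ + (m(z)/z^β) f̂(z))`, where `F` stands for `f̂`. -/
def uHat {n : ℕ} (Ω : Set (E n)) (α β : ℝ) (u₀ : L2R Ω) (F : ℂ → L2C Ω) (z : ℂ) : L2C Ω :=
  resolvent Ω (mFun α β z)
    ((mFun α β z / z) • toC u₀ + (mFun α β z / z ^ (β : ℂ)) • F z)

/-! ## The hyperbolic contour -/

/-- `z(φ) = μ (1 + sin (i φ - θ))`. -/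
def contour (θ μ : ℝ) (φ : ℂ) : ℂ := μ * (1 + Complex.sin (Complex.I * φ - θ))

/-- The open strip `K = {|Im φ| < c}`. -/
def strip (c : ℝ) : Set ℂ := {φ : ℂ | |φ.im| < c}

/-- The image `S` of the strip `K` under `φ ↦ z(φ)`. -/
def region (θ μ c : ℝ) : Set ℂ := contour θ μ '' strip c

/-- `F` is the Laplace transform `f̂(z) = ∫₀^∞ e^(-zt) f(t) dt` of the real source term `f`,
extended holomorphically to `S`: the integral converges on some right half-plane, and `F` is
holomorphic on a connected open set, symmetric about the real axis, which contains that half-plane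
and `S`. -/
def IsSourceTransform {n : ℕ} {Ω : Set (E n)} (f : ℝ → L2R Ω) (F : ℂ → L2C Ω) (S : Set ℂ) :
    Prop :=
  ∃ (D : Set ℂ) (σ : ℝ), IsOpen D ∧ IsPreconnected D ∧ (∀ z ∈ D, conj z ∈ D) ∧
    S ⊆ D ∧ {z : ℂ | σ < z.re} ⊆ D ∧ DifferentiableOn ℂ F D ∧
    ∀ z : ℂ, σ < z.re →
      IntegrableOn (fun t : ℝ => Complex.exp (-(z * t)) • toC (f t)) (Ioi 0) ∧
      F z = ∫ t in Ioi (0 : ℝ), Complex.exp (-(z * t)) • toC (f t)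

/-- `‖F‖_S = sup_{z ∈ S} ‖F(z)‖` in `L²(Ω)`. -/
def supNorm {n : ℕ} {Ω : Set (E n)} (F : ℂ → L2C Ω) (S : Set ℂ) : ℝ :=
  sSup ((fun z => ‖F z‖) '' S)

/-! ## The solution and its approximation -/

/-- The integrand `g(φ,t) = (2πi)⁻¹ e^(z(φ) t) û(z(φ)) z'(φ)`. -/
def integrand {n : ℕ} (Ω : Set (E n)) (α β θ μ : ℝ) (u₀ : L2R Ω) (F : ℂ → L2C Ω)
    (t : ℝ) (φ : ℂ) : L2C Ω :=
  ((2 * Real.pi * Complex.I)⁻¹ * Complex.exp (contour θ μ φ * t) * deriv (contour θ μ) φ) •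
    uHat Ω α β u₀ F (contour θ μ φ)

/-- The solution `u(t) = (2πi)⁻¹ ∫_Γ e^(zt) û(z) dz`, with `Γ` parametrized by `z(φ)`, `φ ∈ ℝ`. -/
def exactSol {n : ℕ} (Ω : Set (E n)) (α β θ μ : ℝ) (u₀ : L2R Ω) (F : ℂ → L2C Ω) (t : ℝ) :
    L2C Ω :=
  ∫ φ : ℝ, integrand Ω α β θ μ u₀ F t φ

/-- The node `φ_k = (k + 1/2) τ`. -/
def node (τ : ℝ) (k : ℕ) : ℝ := (k + 1 / 2) * τ

/-- The scheme `u^N(t) = (τ/π) Im ∑_{k=0}^{N-1} e^(z(φ_k) t) û(z(φ_k)) z'(φ_k)`. -/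
def cimSol {n : ℕ} (Ω : Set (E n)) (α β θ μ τ : ℝ) (N : ℕ) (u₀ : L2R Ω) (F : ℂ → L2C Ω)
    (t : ℝ) : L2R Ω :=
  (τ / Real.pi) • imPart (∑ k ∈ Finset.range N,
    (Complex.exp (contour θ μ (node τ k) * t) * deriv (contour θ μ) (node τ k)) •
      uHat Ω α β u₀ F (contour θ μ (node τ k)))

/-! ## The quantities in the error bound -/

/-- `φ(θ,c) = √((1 + sin(θ+c)) / (1 - sin(θ+c)))`. -/
def phiFactor (θ c : ℝ) : ℝ :=
  Real.sqrt ((1 + Real.sin (θ + c)) / (1 - Real.sin (θ + c)))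

/-- `L(x) = 1 + |ln(1 - e^(-x))|`. -/
def LFun (x : ℝ) : ℝ := 1 + |Real.log (1 - Real.exp (-x))|

/-- `P(η) = arcosh(Λ / ((1-η) sin(θ-c)))`. -/
def PFun (θ c Λ η : ℝ) : ℝ := Real.arcosh (Λ / ((1 - η) * Real.sin (θ - c)))

/-- `μ = 2π c N (1-η) / (Λ t₀ P(η))`. -/
def muParam (θ c t₀ Λ η : ℝ) (N : ℕ) : ℝ :=
  2 * Real.pi * c * N * (1 - η) / (Λ * t₀ * PFun θ c Λ η)

/-- `τ = P(η) / N`. -/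
def tauParam (θ c Λ η : ℝ) (N : ℕ) : ℝ := PFun θ c Λ η / N

end CIM

end

/-!
The proof has two halves.

*Resolvent.* The projection of `(g, 0)` onto `H¹₀(Ω)` in `L² × L²` gives `T = (I + A)⁻¹`, a positive
contraction, and `lam + A` is inverted through `1 + (lam - 1) T`; this makes the resolvent
holomorphic off the negative real axis (`differentiableAt_resolvent`). Testing the equation with its
solution gives `‖(lam + A)⁻¹‖ ≤ 1 / (κ |lam|)` as soon as a rotation moves `1` and `1 / lam` into the
right half-plane with the real part of the former at least `κ` (`norm_resolvent_le`). For
`lam = m(z)` one has `1 / m(z) = z ^ (-β) + z ^ (-(α + β))`, so a rotation by half of the largest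
value of `(α + β) |arg z|` does it. On the strip `|arg z| < π / 2 + θ + c` (`abs_arg_contour_lt`), so
`κ` depends on `α, β, ε` only (`Admissible.isSectorial`).

*Quadrature.* With `|z| = μ (cosh x - sin (θ + y))` and `|z'| ≤ φ(θ,c) |z|` the integrand is bounded
on the strip by a multiple of `exp(-a cosh x)`, where `a = μ t₀ sin (θ - c)`; the integral of this
profile is `O(L(a))` (`integral_coshDecay_le`). By Poisson summation and a shift of contour the
midpoint rule over the whole line has error `O(1 / (exp(2πc/τ) - 1))`
(`norm_integral_sub_smul_tsum_le`). The scheme is the truncation of that rule to `|x| < N τ`, because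
conjugation maps the terms of negative index to those of positive index; this rests on the symmetry
`û(z̄) = conj û(z)`, which for the source follows from the identity theorem
(`IsSourceTransform.conj_apply`). The truncation point `N τ = P(η)` makes
`μ t₀ sin (θ - c) cosh P = 2πc/τ`, so that the discarded terms are of the size of the quadrature
error (`error_factors`).
-/

noncomputable section

namespace CIM

/-! ### The resolvent of the Dirichlet Laplacian -/

section Resolvent

variable {n : ℕ} {Ω : Set (E n)}

instance : (H10 Ω).HasOrthogonalProjection := by
  unfold H10; infer_instance

/-- The embedding `g ↦ (g, 0)` of `L²(Ω)` into `L²(Ω) × L²(Ω)ⁿ`. -/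
def inlL2 (Ω : Set (E n)) : L2C Ω →L[ℂ] WithLp 2 (L2C Ω × L2V Ω) :=
  (WithLp.prodContinuousLinearEquiv 2 ℂ (L2C Ω) (L2V Ω)).symm.toContinuousLinearMap ∘L
    ContinuousLinearMap.inl ℂ (L2C Ω) (L2V Ω)

lemma inner_prodL2 (p q : WithLp 2 (L2C Ω × L2V Ω)) :
    inner ℂ p q = inner ℂ p.fst q.fst + inner ℂ p.snd q.snd := WithLp.prod_inner_apply p q

lemma inner_inlL2_right (p : WithLp 2 (L2C Ω × L2V Ω)) (g : L2C Ω) :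
    inner ℂ p (inlL2 Ω g) = inner ℂ p.fst g := by
  rw [inner_prodL2]
  have h1 : (inlL2 Ω g).fst = g := rfl
  have h2 : (inlL2 Ω g).snd = 0 := rfl
  rw [h1, h2, inner_zero_right, add_zero]

/-- The operator `(I + A)⁻¹`. The `H¹` inner product on `H¹₀(Ω)` is the weak form of `I + A`, so
`(I + A)⁻¹ g` is the first component of the orthogonal projection of `(g, 0)` onto `H¹₀(Ω)`. -/
def invOneAdd (Ω : Set (E n)) : L2C Ω →L[ℂ] L2C Ω :=
  WithLp.fstL 2 ℂ (L2C Ω) (L2V Ω) ∘L (H10 Ω).starProjection ∘L inlL2 Ω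

lemma inner_invOneAdd_right (x y : L2C Ω) :
    inner ℂ x (invOneAdd Ω y) = inner ℂ (inlL2 Ω x) ((H10 Ω).starProjection (inlL2 Ω y)) := by
  rw [← inner_conj_symm, ← inner_conj_symm (inlL2 Ω x), inner_inlL2_right]
  rfl

lemma inner_invOneAdd_left (x y : L2C Ω) :
    inner ℂ (invOneAdd Ω x) y = inner ℂ ((H10 Ω).starProjection (inlL2 Ω x)) (inlL2 Ω y) := by
  rw [inner_inlL2_right]
  rfl

lemma isPositive_invOneAdd (Ω : Set (E n)) : (invOneAdd Ω).IsPositive := by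
  rw [ContinuousLinearMap.isPositive_iff]
  refine ⟨fun x y => ?_, fun x => ?_⟩
  · change inner ℂ (invOneAdd Ω x) y = inner ℂ x (invOneAdd Ω y)
    rw [inner_invOneAdd_left, inner_invOneAdd_right, Submodule.inner_starProjection_left_eq_right]
  · rw [inner_invOneAdd_left]
    have h := (H10 Ω).isIdempotentElem_starProjection
    have h' : (H10 Ω).starProjection ((H10 Ω).starProjection (inlL2 Ω x)) =
        (H10 Ω).starProjection (inlL2 Ω x) := by
      simpa using congrArg (fun T => T (inlL2 Ω x)) h.eq
    rw [← h', Submodule.inner_starProjection_left_eq_right, inner_self_eq_norm_sq_to_K]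
    rw [← RCLike.ofReal_pow]
    exact RCLike.ofReal_nonneg.2 (sq_nonneg _)

lemma norm_invOneAdd_le (Ω : Set (E n)) : ‖invOneAdd Ω‖ ≤ 1 := by
  refine ContinuousLinearMap.opNorm_le_bound _ zero_le_one fun g => ?_
  calc ‖invOneAdd Ω g‖ ≤ ‖(H10 Ω).starProjection (inlL2 Ω g)‖ := WithLp.norm_fst_le _ _
    _ ≤ ‖inlL2 Ω g‖ := Submodule.norm_starProjection_apply_le _ _
    _ = 1 * ‖g‖ := by
        rw [one_mul]
        have : ‖inlL2 Ω g‖ ^ 2 = ‖g‖ ^ 2 := by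
          rw [WithLp.prod_norm_sq_eq_of_L2]
          have h1 : (inlL2 Ω g).fst = g := rfl
          have h2 : (inlL2 Ω g).snd = 0 := rfl
          rw [h1, h2]; simp
        exact (sq_eq_sq₀ (norm_nonneg _) (norm_nonneg _)).1 this

/-- `A w = h` means that `w` is a fixed point of `(I + A)⁻¹ (h + ·)`. -/
lemma isNegLaplacian_iff (w h : L2C Ω) :
    IsNegLaplacian Ω w h ↔ invOneAdd Ω (h + w) = w := by
  constructor
  · rintro ⟨p, hp, rfl, hq⟩
    have : (H10 Ω).starProjection (inlL2 Ω (h + p.fst)) = p := by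
      refine Submodule.eq_starProjection_of_mem_of_inner_eq_zero hp fun q hq' => ?_
      rw [← inner_conj_symm, inner_sub_right, inner_inlL2_right, inner_prodL2, hq q hq',
        inner_add_right, add_comm, sub_self, map_zero]
    change ((H10 Ω).starProjection (inlL2 Ω (h + p.fst))).fst = p.fst
    rw [this]
  · intro hw
    refine ⟨(H10 Ω).starProjection (inlL2 Ω (h + w)), Submodule.starProjection_apply_mem _ _, hw,
      fun q hq => ?_⟩
    have h1 := (H10 Ω).starProjection_inner_eq_zero (inlL2 Ω (h + w)) q hq
    have hw' : ((H10 Ω).starProjection (inlL2 Ω (h + w))).fst = w := hw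
    rw [← inner_conj_symm, inner_sub_right, inner_inlL2_right, inner_prodL2, hw',
      inner_add_right] at h1
    have h2 := (map_eq_zero _).1 h1
    linear_combination -h2

/-- Testing `A w = h` with `w` itself: `⟨w, A w⟩ = ‖∇w‖²`. -/
lemma IsNegLaplacian.exists_energy {w h : L2C Ω} (hw : IsNegLaplacian Ω w h) :
    ∃ r : ℝ, 0 ≤ r ∧ inner ℂ w h = (r : ℂ) := by
  obtain ⟨p, hp, rfl, hq⟩ := hw
  refine ⟨‖p.snd‖ ^ 2, by positivity, ?_⟩
  rw [← hq p hp, inner_self_eq_norm_sq_to_K]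
  push_cast
  rfl

/-- Some line through the origin has `1` and `1 / lam` on the same closed side, and `1` at distance
at least `κ` from it. For `κ > 0` this places `lam` in a sector symmetric about the positive real
axis and of opening angle less than `2π`, on which the resolvent of `A` decays like `1 / |lam|`. -/
def IsSectorial (κ : ℝ) (lam : ℂ) : Prop :=
  lam ≠ 0 ∧ ∃ ζ : ℂ, ‖ζ‖ = 1 ∧ κ ≤ ζ.re ∧ 0 ≤ (ζ / lam).re

lemma IsSectorial.mem_slitPlane {κ : ℝ} (hκ : 0 < κ) {lam : ℂ} (h : IsSectorial κ lam) :
    lam ∈ Complex.slitPlane := by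
  obtain ⟨h0, ζ, -, hζ, hre⟩ := h
  by_contra hs
  rw [Complex.mem_slitPlane_iff, not_or, not_lt, not_not] at hs
  obtain ⟨s, hlam⟩ : ∃ s : ℝ, lam = s := ⟨lam.re, Complex.ext rfl (by simp [hs.2])⟩
  subst hlam
  rw [Complex.div_ofReal_re] at hre
  have h1 : s < 0 := lt_of_le_of_ne (by simpa using hs.1) (by simpa using h0)
  exact absurd hre (not_le.2 (div_neg_of_pos_of_neg (hκ.trans_le hζ) h1))

/-- The resolvent bound `‖(lam + A)⁻¹‖ ≤ 1 / (κ |lam|)`. -/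
lemma norm_le_of_isNegLaplacian {κ : ℝ} (hκ : 0 < κ) {lam : ℂ} (h : IsSectorial κ lam)
    {w g : L2C Ω} (hw : IsNegLaplacian Ω w (g - lam • w)) : ‖w‖ ≤ ‖g‖ / (κ * ‖lam‖) := by
  obtain ⟨h0, ζ, hζ1, hζ, hre⟩ := h
  obtain ⟨r, hr, hE⟩ := hw.exists_energy
  rw [inner_sub_right, inner_smul_right, inner_self_eq_norm_sq_to_K] at hE
  have hlam : 0 < ‖lam‖ := norm_pos_iff.2 h0
  have key : ζ * inner ℂ w g / lam = (r : ℂ) * (ζ / lam) + ((‖w‖ ^ 2 : ℝ) : ℂ) * ζ := by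
    have : inner ℂ w g = (r : ℂ) + lam * ((‖w‖ ^ 2 : ℝ) : ℂ) := by
      push_cast
      linear_combination hE
    rw [this]
    field_simp
  have hle : κ * ‖w‖ ^ 2 ≤ ‖w‖ * ‖g‖ / ‖lam‖ := by
    calc κ * ‖w‖ ^ 2 ≤ r * (ζ / lam).re + ‖w‖ ^ 2 * ζ.re := by
          nlinarith [mul_nonneg hr hre, sq_nonneg ‖w‖]
      _ = (ζ * inner ℂ w g / lam).re := by
          rw [key, Complex.add_re, Complex.re_ofReal_mul, Complex.re_ofReal_mul]
      _ ≤ ‖ζ * inner ℂ w g / lam‖ := Complex.re_le_norm _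
      _ = ‖inner ℂ w g‖ / ‖lam‖ := by rw [norm_div, norm_mul, hζ1, one_mul]
      _ ≤ ‖w‖ * ‖g‖ / ‖lam‖ := by gcongr; exact norm_inner_le_norm _ _
  rcases (norm_nonneg w).eq_or_lt with hw0 | hw0
  · rw [← hw0]; positivity
  · rw [le_div_iff₀ (by positivity)]
    rw [le_div_iff₀ hlam] at hle
    have : ‖w‖ * (‖w‖ * (κ * ‖lam‖)) ≤ ‖w‖ * ‖g‖ := by linarith
    exact le_of_mul_le_mul_left this hw0

/-- `lam + A = (I + (lam - 1) (I + A)⁻¹) (I + A)` is invertible off the negative real axis, since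
the spectrum of `(I + A)⁻¹` lies in `[0, 1]`. -/
lemma isUnit_one_add_smul {lam : ℂ} (h : lam ∈ Complex.slitPlane) :
    IsUnit (1 + (lam - 1) • invOneAdd Ω) := by
  rcases eq_or_ne lam 1 with rfl | h1
  · simp
  have h1' : lam - 1 ≠ 0 := sub_ne_zero.2 h1
  by_contra hu
  set s : ℂ := -(lam - 1)⁻¹ with hs
  have hmem : s ∈ spectrum ℂ (invOneAdd Ω) := by
    rw [spectrum.mem_iff]
    intro hu'
    apply hu
    have : 1 + (lam - 1) • invOneAdd Ω =
        (Units.mk0 (-(lam - 1)) (neg_ne_zero.2 h1')) •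
          (algebraMap ℂ (L2C Ω →L[ℂ] L2C Ω) s - invOneAdd Ω) := by
      rw [Units.smul_def, Units.val_mk0, smul_sub, Algebra.algebraMap_eq_smul_one, smul_smul, hs]
      rw [neg_mul_neg, mul_inv_cancel₀ h1', one_smul, neg_smul, sub_neg_eq_add]
    rw [this]
    exact hu'.smul _
  have hpos := isPositive_invOneAdd Ω
  have hre : s = s.re := hpos.isSelfAdjoint.mem_spectrum_eq_re hmem
  have hnn : 0 ≤ s.re := by
    have hR : s.re ∈ spectrum ℝ (invOneAdd Ω) := by
      rw [spectrum.mem_iff] at hmem ⊢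
      rw [hre] at hmem
      exact hmem
    exact (SpectrumRestricts.nnreal_iff.mp hpos.spectrumRestricts) _ hR
  have hle : s.re ≤ 1 := by
    have h2 := spectrum.norm_le_norm_mul_of_mem hmem
    have h3 : ‖(1 : L2C Ω →L[ℂ] L2C Ω)‖ ≤ 1 := ContinuousLinearMap.norm_id_le
    calc s.re ≤ ‖s‖ := Complex.re_le_norm s
      _ ≤ ‖invOneAdd Ω‖ * ‖(1 : L2C Ω →L[ℂ] L2C Ω)‖ := h2
      _ ≤ 1 * 1 := by gcongr; exact norm_invOneAdd_le Ω
      _ = 1 := one_mul 1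
  have hs0 : s ≠ 0 := by simpa [hs] using h1'
  have hsp : 0 < s.re := lt_of_le_of_ne hnn fun h0 => hs0 (by rw [hre, ← h0]; simp)
  have hlam : lam = ((1 - 1 / s.re : ℝ) : ℂ) := by
    push_cast
    rw [← hre, hs]
    field_simp
    ring
  rw [hlam, Complex.ofReal_mem_slitPlane, sub_pos, div_lt_one hsp] at h
  exact absurd h (not_lt.2 hle)

lemma isNegLaplacian_sub_smul_iff (lam : ℂ) (w g : L2C Ω) :
    IsNegLaplacian Ω w (g - lam • w) ↔ (1 + (lam - 1) • invOneAdd Ω) w = invOneAdd Ω g := by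
  rw [isNegLaplacian_iff]
  have : g - lam • w + w = g - (lam - 1) • w := by rw [sub_smul, one_smul]; abel
  rw [this, map_sub, map_smul]
  simp only [add_apply, one_apply_eq_self, smul_apply]
  constructor <;> intro h
  · nth_rewrite 1 [← h]; abel
  · rw [← h]; abel

/-- The equation `A w = g - lam w` has exactly one solution when `lam` is off the negative real
axis, so that `resolvent` takes no junk value there. -/
lemma isNegLaplacian_iff_eq_resolvent {lam : ℂ} (h : lam ∈ Complex.slitPlane) (w g : L2C Ω) :
    IsNegLaplacian Ω w (g - lam • w) ↔ w = resolvent Ω lam g := by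
  obtain ⟨U, hU⟩ := isUnit_one_add_smul (Ω := Ω) h
  have hex : ∃ w : L2C Ω, IsNegLaplacian Ω w (g - lam • w) := by
    refine ⟨(↑U⁻¹ : L2C Ω →L[ℂ] L2C Ω) (invOneAdd Ω g), ?_⟩
    rw [isNegLaplacian_sub_smul_iff, ← hU]
    change ((U : L2C Ω →L[ℂ] L2C Ω) * ((U⁻¹ : (L2C Ω →L[ℂ] L2C Ω)ˣ) : L2C Ω →L[ℂ] L2C Ω))
      (invOneAdd Ω g) = _
    rw [U.mul_inv]; rfl
  have hspec : IsNegLaplacian Ω (resolvent Ω lam g) (g - lam • resolvent Ω lam g) := by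
    unfold resolvent
    rw [dif_pos hex]
    exact hex.choose_spec
  constructor
  · intro hw
    rw [isNegLaplacian_sub_smul_iff, ← hU] at hw hspec
    have h2 := congrArg (fun v => ((U⁻¹ : (L2C Ω →L[ℂ] L2C Ω)ˣ) : L2C Ω →L[ℂ] L2C Ω) v)
      (hw.trans hspec.symm)
    change (((U⁻¹ : (L2C Ω →L[ℂ] L2C Ω)ˣ) : L2C Ω →L[ℂ] L2C Ω) * U) w =
      (((U⁻¹ : (L2C Ω →L[ℂ] L2C Ω)ˣ) : L2C Ω →L[ℂ] L2C Ω) * U) _ at h2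
    rw [U.inv_mul] at h2
    exact h2
  · rintro rfl
    exact hspec

lemma norm_resolvent_le {κ : ℝ} (hκ : 0 < κ) {lam : ℂ} (h : IsSectorial κ lam) (g : L2C Ω) :
    ‖resolvent Ω lam g‖ ≤ ‖g‖ / (κ * ‖lam‖) :=
  norm_le_of_isNegLaplacian hκ h
    ((isNegLaplacian_iff_eq_resolvent (h.mem_slitPlane hκ) _ _).2 rfl)

lemma resolvent_eq_inverse {lam : ℂ} (h : lam ∈ Complex.slitPlane) (g : L2C Ω) :
    resolvent Ω lam g =
      Ring.inverse (1 + (lam - 1) • invOneAdd Ω) (invOneAdd Ω g) := by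
  symm
  rw [← isNegLaplacian_iff_eq_resolvent h, isNegLaplacian_sub_smul_iff]
  change ((1 + (lam - 1) • invOneAdd Ω) * Ring.inverse (1 + (lam - 1) • invOneAdd Ω)) _ = _
  rw [Ring.mul_inverse_cancel _ (isUnit_one_add_smul h)]
  rfl

/-- The resolvent of `A` is holomorphic off the negative real axis. -/
lemma differentiableAt_resolvent {m : ℂ → ℂ} {G : ℂ → L2C Ω} {z : ℂ}
    (hm : DifferentiableAt ℂ m z) (hG : DifferentiableAt ℂ G z)
    (hz : m z ∈ Complex.slitPlane) :
    DifferentiableAt ℂ (fun w => resolvent Ω (m w) (G w)) z := by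
  have hev : (fun w => resolvent Ω (m w) (G w)) =ᶠ[nhds z] fun w =>
      Ring.inverse (1 + (m w - 1) • invOneAdd Ω) (invOneAdd Ω (G w)) := by
    filter_upwards [hm.continuousAt.eventually (Complex.isOpen_slitPlane.mem_nhds hz)] with w hw
    exact resolvent_eq_inverse hw _
  refine DifferentiableAt.congr_of_eventuallyEq ?_ hev
  have h1 : DifferentiableAt ℂ (fun w => 1 + (m w - 1) • invOneAdd Ω) z := by fun_prop
  have h2 : DifferentiableAt ℂ (fun w => Ring.inverse (1 + (m w - 1) • invOneAdd Ω)) z :=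
    DifferentiableAt.inverse h1 (isUnit_one_add_smul hz)
  exact h2.clm_apply ((invOneAdd Ω).differentiableAt.comp z hG)

end Resolvent

/-! ### Complex conjugation on `L²(Ω)` -/

section Conjugation

variable {n : ℕ} {Ω : Set (E n)}

/-- Complex conjugation on `L²(Ω)`. -/
def conjL2 (Ω : Set (E n)) : L2C Ω →L⋆[ℂ] L2C Ω :=
  (starL ℂ : ℂ ≃L⋆[ℂ] ℂ).toContinuousLinearMap.compLpL 2 (volume.restrict Ω)

/-- Componentwise complex conjugation on `ℂⁿ`. -/
def conjVec (n : ℕ) : EuclideanSpace ℂ (Fin n) →L⋆[ℂ] EuclideanSpace ℂ (Fin n) where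
  toFun v := WithLp.toLp 2 fun i => conj (v i)
  map_add' v w := by ext i; simp
  map_smul' c v := by ext i; simp
  cont := by
    refine (PiLp.continuous_toLp 2 _).comp (continuous_pi fun i => ?_)
    exact Complex.continuous_conj.comp (PiLp.continuous_apply 2 _ i)

/-- Complex conjugation on `L²(Ω)ⁿ`. -/
def conjL2Vec (Ω : Set (E n)) : L2V Ω →L⋆[ℂ] L2V Ω :=
  (conjVec n).compLpL 2 (volume.restrict Ω)

lemma coeFn_conjL2 (w : L2C Ω) : conjL2 Ω w =ᵐ[volume.restrict Ω] fun x => conj (w x) :=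
  ContinuousLinearMap.coeFn_compLpL _ w

lemma coeFn_conjL2Vec (w : L2V Ω) :
    conjL2Vec Ω w =ᵐ[volume.restrict Ω] fun x => conjVec n (w x) :=
  ContinuousLinearMap.coeFn_compLpL _ w

lemma conjL2_conjL2 (w : L2C Ω) : conjL2 Ω (conjL2 Ω w) = w := by
  refine Lp.ext ?_
  filter_upwards [coeFn_conjL2 (conjL2 Ω w), coeFn_conjL2 w] with x h1 h2
  rw [h1, h2, Complex.conj_conj]

lemma norm_conjL2 (w : L2C Ω) : ‖conjL2 Ω w‖ = ‖w‖ := by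
  rw [Lp.norm_def, Lp.norm_def]
  congr 1
  refine eLpNorm_congr_norm_ae ?_
  filter_upwards [coeFn_conjL2 w] with x h1
  rw [h1]
  exact RCLike.norm_conj _

lemma inner_conjL2 (a b : L2C Ω) :
    inner ℂ (conjL2 Ω a) (conjL2 Ω b) = conj (inner ℂ a b) := by
  rw [L2.inner_def, L2.inner_def, ← integral_conj]
  refine integral_congr_ae ?_
  filter_upwards [coeFn_conjL2 a, coeFn_conjL2 b] with x h1 h2
  simp only [h1, h2]
  simp [RCLike.inner_apply]

lemma inner_conjL2Vec (a b : L2V Ω) :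
    inner ℂ (conjL2Vec Ω a) (conjL2Vec Ω b) = conj (inner ℂ a b) := by
  rw [L2.inner_def, L2.inner_def, ← integral_conj]
  refine integral_congr_ae ?_
  filter_upwards [coeFn_conjL2Vec a, coeFn_conjL2Vec b] with x h1 h2
  simp only [h1, h2]
  rw [PiLp.inner_apply, PiLp.inner_apply, map_sum]
  refine Finset.sum_congr rfl fun i _ => ?_
  simp [conjVec, RCLike.inner_apply]

lemma IsTest.conj {φ : E n → ℂ} (h : IsTest Ω φ) : IsTest Ω (fun x => conj (φ x)) where
  smooth := Complex.conjCLE.contDiff.comp h.smooth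
  compact := h.compact.comp_left (g := fun z : ℂ => (starRingEnd ℂ) z) (map_zero _)
  subset := (tsupport_comp_subset (g := fun z : ℂ => (starRingEnd ℂ) z) (map_zero _) φ).trans
    h.subset

lemma grad_conj (φ : E n → ℂ) (x : E n) :
    grad (fun x => conj (φ x)) x = conjVec n (grad φ x) := by
  ext i
  have h : fderiv ℝ (fun x => (starRingEnd ℂ) (φ x)) x =
      (Complex.conjCLE : ℂ →L[ℝ] ℂ).comp (fderiv ℝ φ x) :=
    Complex.conjCLE.comp_fderiv (f := φ) (x := x)
  simp [grad, conjVec, h]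

/-- Complex conjugation on pairs `(w, ∇w)`. -/
def conjPair (Ω : Set (E n)) :
    WithLp 2 (L2C Ω × L2V Ω) →L⋆[ℂ] WithLp 2 (L2C Ω × L2V Ω) where
  toFun p := WithLp.toLp 2 (conjL2 Ω p.fst, conjL2Vec Ω p.snd)
  map_add' p q := by
    apply WithLp.ofLp_injective
    ext1
    · exact map_add (conjL2 Ω) p.fst q.fst
    · exact map_add (conjL2Vec Ω) p.snd q.snd
  map_smul' c p := by
    apply WithLp.ofLp_injective
    ext1
    · exact (conjL2 Ω).map_smulₛₗ c p.fst
    · exact (conjL2Vec Ω).map_smulₛₗ c p.snd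
  cont := by
    refine (WithLp.prod_continuous_toLp 2 _ _).comp (Continuous.prodMk ?_ ?_)
    · exact (conjL2 Ω).continuous.comp (WithLp.fstL 2 ℂ (L2C Ω) (L2V Ω)).continuous
    · exact (conjL2Vec Ω).continuous.comp (WithLp.sndL 2 ℂ (L2C Ω) (L2V Ω)).continuous

lemma conjPair_mem_H10 {p : WithLp 2 (L2C Ω × L2V Ω)} (hp : p ∈ H10 Ω) :
    conjPair Ω p ∈ H10 Ω := by
  unfold H10 at hp ⊢
  refine map_mem_closure (conjPair Ω).continuous hp fun q hq => ?_
  induction hq using Submodule.span_induction with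
  | mem q hq =>
    obtain ⟨φ, hφ, h1, h2⟩ := hq
    refine Submodule.subset_span ⟨fun x => conj (φ x), hφ.conj, ?_, ?_⟩
    · filter_upwards [coeFn_conjL2 q.fst, h1] with x hx h1x
      rw [← h1x]
      exact hx
    · filter_upwards [coeFn_conjL2Vec q.snd, h2] with x hx h2x
      rw [grad_conj, ← h2x]
      exact hx
  | zero => rw [map_zero]; exact Submodule.zero_mem _
  | add x y _ _ hx hy => rw [map_add]; exact Submodule.add_mem _ hx hy
  | smul c x _ hx =>
    rw [(conjPair Ω).map_smulₛₗ]
    exact Submodule.smul_mem _ _ hx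

lemma conjPair_conjPair (p : WithLp 2 (L2C Ω × L2V Ω)) : conjPair Ω (conjPair Ω p) = p := by
  apply WithLp.ofLp_injective
  ext1
  · exact conjL2_conjL2 p.fst
  · refine Lp.ext ?_
    filter_upwards [coeFn_conjL2Vec (conjL2Vec Ω p.snd), coeFn_conjL2Vec p.snd] with x h1 h2
    refine h1.trans ?_
    rw [h2]
    ext i
    simp [conjVec]

lemma IsNegLaplacian.conj {w h : L2C Ω} (hw : IsNegLaplacian Ω w h) :
    IsNegLaplacian Ω (conjL2 Ω w) (conjL2 Ω h) := by
  obtain ⟨p, hp, rfl, hq⟩ := hw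
  refine ⟨conjPair Ω p, conjPair_mem_H10 hp, rfl, fun q hq' => ?_⟩
  have h1 := hq _ (conjPair_mem_H10 hq')
  rw [← conjPair_conjPair q]
  change inner ℂ (conjL2Vec Ω (conjPair Ω q).snd) (conjL2Vec Ω p.snd) =
    inner ℂ (conjL2 Ω (conjPair Ω q).fst) (conjL2 Ω h)
  rw [inner_conjL2, inner_conjL2Vec, h1]

lemma conj_mem_slitPlane {z : ℂ} (h : z ∈ Complex.slitPlane) : conj z ∈ Complex.slitPlane := by
  rw [Complex.mem_slitPlane_iff] at h ⊢
  simpa using h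

lemma conjL2_resolvent {lam : ℂ} (h : lam ∈ Complex.slitPlane) (g : L2C Ω) :
    conjL2 Ω (resolvent Ω lam g) = resolvent Ω (conj lam) (conjL2 Ω g) := by
  rw [← isNegLaplacian_iff_eq_resolvent (conj_mem_slitPlane h), ← (conjL2 Ω).map_smulₛₗ,
    ← map_sub]
  exact ((isNegLaplacian_iff_eq_resolvent h _ _).2 rfl).conj

lemma coeFn_toC (u : L2R Ω) : toC u =ᵐ[volume.restrict Ω] fun x => ((u x : ℝ) : ℂ) :=
  ContinuousLinearMap.coeFn_compLp' _ u

lemma norm_toC_le (u : L2R Ω) : ‖toC u‖ ≤ ‖u‖ := by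
  have := Complex.ofRealCLM.norm_compLp_le u
  rwa [Complex.ofRealCLM_norm, one_mul] at this

lemma conjL2_toC (u : L2R Ω) : conjL2 Ω (toC u) = toC u := by
  refine Lp.ext ?_
  filter_upwards [coeFn_conjL2 (toC u), coeFn_toC u] with x h1 h2
  rw [h1, h2, Complex.conj_ofReal]

lemma toC_smul_imPart (r : ℝ) (w : L2C Ω) :
    toC (r • imPart w) = ((r : ℂ) * (2 * Complex.I)⁻¹) • (w - conjL2 Ω w) := by
  refine Lp.ext ?_
  have him : imPart w =ᵐ[volume.restrict Ω] fun x => (w x).im :=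
    ContinuousLinearMap.coeFn_compLp' Complex.imCLM w
  filter_upwards [coeFn_toC (r • imPart w), Lp.coeFn_smul r (imPart w), him,
    Lp.coeFn_smul ((r : ℂ) * (2 * Complex.I)⁻¹) (w - conjL2 Ω w), Lp.coeFn_sub w (conjL2 Ω w),
    coeFn_conjL2 w] with x h1 h2 h3 h4 h5 h6
  rw [h1, h2, h4, Pi.smul_apply, Pi.smul_apply, h5, Pi.sub_apply, h6, h3, smul_eq_mul, smul_eq_mul,
    Complex.sub_conj]
  push_cast
  have := Complex.I_ne_zero
  field_simp

/-- The conjugate of a holomorphic `L²(Ω)`-valued function, precomposed with conjugation, is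
holomorphic. -/
lemma differentiableAt_conjL2_comp_conj {F : ℂ → L2C Ω} {z : ℂ}
    (hF : DifferentiableAt ℂ F (conj z)) :
    DifferentiableAt ℂ (fun w => conjL2 Ω (F (conj w))) z := by
  have h := hF.hasDerivAt
  rw [hasDerivAt_iff_tendsto_slope] at h
  refine HasDerivAt.differentiableAt (f' := conjL2 Ω (deriv F (conj z))) ?_
  rw [hasDerivAt_iff_tendsto_slope]
  have hc : Filter.Tendsto (fun w : ℂ => conj w) (nhdsWithin z {z}ᶜ)
      (nhdsWithin (conj z) {conj z}ᶜ) := by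
    refine tendsto_nhdsWithin_of_tendsto_nhds_of_eventually_within _
      (Complex.continuous_conj.continuousAt.tendsto.mono_left nhdsWithin_le_nhds) ?_
    filter_upwards [self_mem_nhdsWithin] with w hw
    exact fun h => hw ((starRingEnd ℂ).injective h)
  refine (((conjL2 Ω).continuous.tendsto _).comp (h.comp hc)).congr fun w => ?_
  simp only [Function.comp_apply, slope_def_module, (conjL2 Ω).map_smulₛₗ, map_sub, map_inv₀,
    Complex.conj_conj]

/-- Schwarz reflection for the transform of a real source: the symmetry holds on the half-plane of
convergence and spreads by the identity theorem. -/
lemma IsSourceTransform.conj_apply {f : ℝ → L2R Ω} {F : ℂ → L2C Ω} {S : Set ℂ}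
    (h : IsSourceTransform f F S) : ∀ z ∈ S, F (conj z) = conjL2 Ω (F z) := by
  obtain ⟨D, σ, hDo, hDc, hDs, hSD, hσD, hF, hint⟩ := h
  have hF' : DifferentiableOn ℂ (fun w => conjL2 Ω (F (conj w))) D := fun z hz =>
    (differentiableAt_conjL2_comp_conj
      (hF.differentiableAt (hDo.mem_nhds (hDs z hz)))).differentiableWithinAt
  have hhalf : ∀ z : ℂ, σ < z.re → F z = conjL2 Ω (F (conj z)) := by
    intro z hz
    obtain ⟨-, h1⟩ := hint z hz
    obtain ⟨h3, h2⟩ := hint (conj z) (by simpa using hz)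
    rw [h1, h2, ← (conjL2 Ω).integral_comp_commSL (by intro r x; simp) h3]
    refine integral_congr_ae (Filter.Eventually.of_forall fun t => ?_)
    simp only [(conjL2 Ω).map_smulₛₗ, conjL2_toC, ← Complex.exp_conj]
    simp
  have hz₀ : ((σ + 1 : ℝ) : ℂ) ∈ {z : ℂ | σ < z.re} := by simp
  have hopen : IsOpen {z : ℂ | σ < z.re} := isOpen_lt continuous_const Complex.continuous_re
  have heq := (hF.analyticOnNhd hDo).eqOn_of_preconnected_of_eventuallyEq (hF'.analyticOnNhd hDo)
    hDc (hσD hz₀) (Filter.eventually_of_mem (hopen.mem_nhds hz₀) hhalf)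
  intro z hz
  rw [heq (hDs z (hSD hz))]
  simp

end Conjugation

/-! ### The midpoint rule for holomorphic functions on a strip -/

section Quadrature

open Filter Topology

/-- Shift of the line of integration inside a strip. -/
lemma integral_horizontal_shift {f : ℂ → ℂ} {d y : ℝ} {G : ℝ → ℝ}
    (hf : DifferentiableOn ℂ f (strip d)) (hy : |y| < d)
    (hfi : Integrable fun x : ℝ => f x) (hfy : Integrable fun x : ℝ => f (x + y * Complex.I))
    (hG : ∀ w ∈ strip d, ‖f w‖ ≤ G w.re) (hG0 : Tendsto G (cocompact ℝ) (𝓝 0)) :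
    ∫ x : ℝ, f x = ∫ x : ℝ, f (x + y * Complex.I) := by
  have hstrip : ∀ s ∈ uIcc 0 y, ∀ x : ℝ, (x + s * Complex.I : ℂ) ∈ strip d := by
    intro s hs x
    have : |s| ≤ |y| := by
      rcases le_total 0 y with h | h
      · rw [uIcc_of_le h] at hs
        rw [abs_of_nonneg hs.1, abs_of_nonneg h]; exact hs.2
      · rw [uIcc_of_ge h] at hs
        rw [abs_of_nonpos hs.2, abs_of_nonpos h]; linarith [hs.1]
    simpa [strip] using this.trans_lt hy
  have hside : ∀ u : ℕ → ℝ, Tendsto u atTop (cocompact ℝ) →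
      Tendsto (fun k => ∫ s in (0 : ℝ)..y, f (u k + s * Complex.I)) atTop (𝓝 0) := by
    intro u hu
    have h1 : Tendsto (fun k => G (u k) * |y|) atTop (𝓝 0) := by
      simpa using (hG0.comp hu).mul_const |y|
    refine squeeze_zero_norm (fun k => ?_) h1
    have := intervalIntegral.norm_integral_le_of_norm_le_const (a := 0) (b := y)
      (f := fun s : ℝ => f (u k + s * Complex.I)) (C := G (u k)) fun s hs => by
        simpa using hG _ (hstrip s (uIoc_subset_uIcc hs) (u k))
    simpa using this
  have hnat : Tendsto (fun k : ℕ => (k : ℝ)) atTop atTop := tendsto_natCast_atTop_atTop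
  have hneg : Tendsto (fun k : ℕ => -(k : ℝ)) atTop atBot := tendsto_neg_atTop_atBot.comp hnat
  have hL1 := intervalIntegral_tendsto_integral hfi hneg hnat
  have hL2 := intervalIntegral_tendsto_integral hfy hneg hnat
  have hR1 := hside (fun k => (k : ℝ)) (hnat.mono_right (by
    rw [cocompact_eq_atBot_atTop]; exact le_sup_right))
  have hR2 := hside (fun k => -(k : ℝ)) (hneg.mono_right (by
    rw [cocompact_eq_atBot_atTop]; exact le_sup_left))
  have hrect : ∀ k : ℕ, (∫ x in (-(k : ℝ))..k, f x) - (∫ x in (-(k : ℝ))..k, f (x + y * Complex.I))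
      + Complex.I * (∫ s in (0 : ℝ)..y, f (((k : ℝ) : ℂ) + s * Complex.I))
      - Complex.I * (∫ s in (0 : ℝ)..y, f (((-(k : ℝ) : ℝ) : ℂ) + s * Complex.I)) = 0 := by
    intro k
    have := Complex.integral_boundary_rect_eq_zero_of_differentiableOn f
      (⟨-(k : ℝ), 0⟩ : ℂ) (⟨k, y⟩ : ℂ) (hf.mono fun w hw => by
        have h1 := hstrip w.im (by simpa using hw.2) w.re
        rwa [Complex.re_add_im] at h1)
    simpa using this
  have hlim := ((hL1.sub hL2).add (hR1.const_mul Complex.I)).sub (hR2.const_mul Complex.I)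
  have h0 := tendsto_nhds_unique hlim (tendsto_const_nhds.congr fun k => (hrect k).symm)
  simp only [mul_zero, add_zero, sub_zero] at h0
  exact sub_eq_zero.1 h0

/-- Exponential decay of the Fourier transform of a function holomorphic on a strip. -/
lemma norm_fourier_le {f : ℂ → ℂ} {d y : ℝ} {G : ℝ → ℝ}
    (hf : DifferentiableOn ℂ f (strip d)) (hy : |y| < d)
    (hG : ∀ w ∈ strip d, ‖f w‖ ≤ G w.re) (hG0 : Tendsto G (cocompact ℝ) (𝓝 0))
    (hGi : Integrable G) (ξ : ℝ) :
    ‖FourierTransform.fourier (fun x : ℝ => f x) ξ‖ ≤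
      Real.exp (2 * Real.pi * ξ * y) * ∫ x, G x := by
  have hcont : ∀ s : ℝ, |s| < d → Continuous fun x : ℝ => f (x + s * Complex.I) := by
    intro s hs
    refine hf.continuousOn.comp_continuous (by fun_prop) fun x => ?_
    simpa [strip] using hs
  set e : ℂ → ℂ := fun w => Complex.exp (-2 * Real.pi * ξ * w * Complex.I) * f w with he
  have hnorm : ∀ w : ℂ, ‖Complex.exp (-2 * Real.pi * ξ * w * Complex.I)‖ =
      Real.exp (2 * Real.pi * ξ * w.im) := by
    intro w
    rw [Complex.norm_exp]
    congr 1
    simp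
  set K : ℝ := Real.exp (2 * Real.pi * |ξ| * d) with hK
  have hbd : ∀ w ∈ strip d, ‖e w‖ ≤ K * G w.re := by
    intro w hw
    rw [he]
    simp only [norm_mul, hnorm]
    have h1 : ξ * w.im ≤ |ξ| * d := (le_abs_self _).trans (by
      rw [abs_mul]; exact mul_le_mul_of_nonneg_left (le_of_lt hw) (abs_nonneg _))
    have h2 : 2 * Real.pi * ξ * w.im ≤ 2 * Real.pi * |ξ| * d := by
      nlinarith [Real.pi_pos]
    have := hG w hw
    have h3 : Real.exp (2 * Real.pi * ξ * w.im) ≤ K := Real.exp_le_exp.2 h2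
    gcongr
  have heD : DifferentiableOn ℂ e (strip d) := by
    refine DifferentiableOn.mul ?_ hf
    exact Differentiable.differentiableOn (by fun_prop)
  have hint : ∀ s : ℝ, |s| < d → Integrable fun x : ℝ => e (x + s * Complex.I) := by
    intro s hs
    refine (hGi.const_mul K).mono' ?_ (Eventually.of_forall fun x => ?_)
    · refine Continuous.aestronglyMeasurable ?_
      exact (Complex.continuous_exp.comp (by fun_prop)).mul (hcont s hs)
    · have := hbd (x + s * Complex.I) (by simpa [strip] using hs)
      simpa using this
  have hd : 0 < d := (abs_nonneg y).trans_lt hy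
  have h0 := hint 0 (by simpa using hd)
  simp only [Complex.ofReal_zero, zero_mul, add_zero] at h0
  have hF : FourierTransform.fourier (fun x : ℝ => f x) ξ = ∫ x : ℝ, e x := by
    rw [Real.fourier_real_eq_integral_exp_smul]
    refine integral_congr_ae (Eventually.of_forall fun x => ?_)
    simp only [he, smul_eq_mul]
    congr 2
    push_cast
    ring
  rw [hF, integral_horizontal_shift heD hy h0 (hint y hy) hbd (by simpa using hG0.const_mul K),
    ← integral_const_mul]
  refine norm_integral_le_of_norm_le (hGi.const_mul _) (Eventually.of_forall fun x => ?_)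
  simp only [he, norm_mul, hnorm]
  have := hG (x + y * Complex.I) (by simpa [strip] using hy)
  have h1 : (x + y * Complex.I : ℂ).im = y := by simp
  have h2 : (x + y * Complex.I : ℂ).re = x := by simp
  rw [h1]
  rw [h2] at this
  gcongr

lemma norm_fourier_le_exp_neg {f : ℂ → ℂ} {d : ℝ} {G : ℝ → ℝ} (hd : 0 < d)
    (hf : DifferentiableOn ℂ f (strip d))
    (hG : ∀ w ∈ strip d, ‖f w‖ ≤ G w.re) (hG0 : Tendsto G (cocompact ℝ) (𝓝 0))
    (hGi : Integrable G) (ξ : ℝ) :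
    ‖FourierTransform.fourier (fun x : ℝ => f x) ξ‖ ≤
      Real.exp (-(2 * Real.pi * |ξ| * d)) * ∫ x, G x := by
  -- the bound for all `|y| < d` passes to the limit `|y| → d`
  have key : ∀ y ∈ Ioo 0 d, ‖FourierTransform.fourier (fun x : ℝ => f x) ξ‖ ≤
      Real.exp (-(2 * Real.pi * |ξ| * y)) * ∫ x, G x := by
    intro y hy
    rcases le_total 0 ξ with h | h
    · have := norm_fourier_le (y := -y) hf (by rw [abs_neg, abs_of_pos hy.1]; exact hy.2) hG hG0
        hGi ξ
      rw [abs_of_nonneg h]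
      convert this using 3
      ring
    · have := norm_fourier_le (y := y) hf (by rw [abs_of_pos hy.1]; exact hy.2) hG hG0 hGi ξ
      rw [abs_of_nonpos h]
      convert this using 3
      ring
  have hlim : Tendsto (fun y : ℝ => Real.exp (-(2 * Real.pi * |ξ| * y)) * ∫ x, G x) (𝓝[<] d)
      (𝓝 (Real.exp (-(2 * Real.pi * |ξ| * d)) * ∫ x, G x)) := by
    refine Tendsto.mono_left ?_ nhdsWithin_le_nhds
    exact Continuous.tendsto (by fun_prop) d
  exact ge_of_tendsto hlim (eventually_of_mem (Ioo_mem_nhdsLT hd) key)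

/-- The midpoint rule with step one: by Poisson summation the error is the alternating sum of the
Fourier transform over the nonzero integers, which the strip makes exponentially small. -/
lemma norm_integral_sub_tsum_le {f : ℂ → ℂ} {d : ℝ} {G : ℝ → ℝ} (hd : 0 < d)
    (hf : DifferentiableOn ℂ f (strip d))
    (hG : ∀ w ∈ strip d, ‖f w‖ ≤ G w.re)
    (hGO : G =O[cocompact ℝ] fun x : ℝ => |x| ^ (-2 : ℝ)) (hGi : Integrable G) :
    ‖(∫ x : ℝ, f x) - ∑' k : ℤ, f (((1 / 2 : ℝ) + k : ℝ))‖ ≤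
      2 * (∫ x, G x) / (Real.exp (2 * Real.pi * d) - 1) := by
  have hG0 : Tendsto G (cocompact ℝ) (𝓝 0) := by
    refine hGO.trans_tendsto ?_
    exact (tendsto_rpow_neg_atTop (by norm_num : (0 : ℝ) < 2)).comp tendsto_norm_cocompact_atTop
  set q : ℝ := Real.exp (-(2 * Real.pi * d)) with hq
  have hq0 : 0 < q := Real.exp_pos _
  have hq1 : q < 1 := by
    rw [hq, Real.exp_lt_one_iff]
    have := Real.pi_pos
    have : 0 < 2 * Real.pi * d := by positivity
    linarith
  set J := ∫ x, G x with hJ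
  have hF : ∀ m : ℕ, ∀ s : ℤ, |s| = m →
      ‖FourierTransform.fourier (fun x : ℝ => f x) s‖ ≤ q ^ m * J := by
    intro m s hs
    refine (norm_fourier_le_exp_neg hd hf hG hG0 hGi s).trans_eq ?_
    have : |(s : ℝ)| = m := by exact_mod_cast hs
    rw [this, hq, ← Real.exp_nat_mul]
    congr 2
    ring
  have hJ0 : 0 ≤ J := by
    have := hF 0 0 (by simp)
    rw [pow_zero, one_mul] at this
    exact (norm_nonneg _).trans this
  have hgeo : Summable fun m : ℕ => q ^ m * J :=
    (summable_geometric_of_lt_one hq0.le hq1).mul_right J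
  have hgeo1 : HasSum (fun m : ℕ => q ^ (m + 1) * J) (q / (1 - q) * J) := by
    have := ((hasSum_geometric_of_lt_one hq0.le hq1).mul_left q).mul_right J
    simpa [pow_succ', div_eq_mul_inv] using this
  have hsum : Summable fun s : ℤ => FourierTransform.fourier (fun x : ℝ => f x) s := by
    refine Summable.of_nat_of_neg ?_ ?_
    · exact Summable.of_norm_bounded hgeo fun m => hF m m (by simp)
    · exact Summable.of_norm_bounded hgeo fun m => by
        have := hF m (-m) (by simp)
        exact_mod_cast this
  have hfc : Continuous fun x : ℝ => f x :=
    hf.continuousOn.comp_continuous Complex.continuous_ofReal fun x => by simpa [strip] using hd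
  have hfO : (fun x : ℝ => f x) =O[cocompact ℝ] fun x : ℝ => |x| ^ (-2 : ℝ) := by
    refine (Asymptotics.isBigO_of_le _ fun x => ?_).trans hGO
    have := hG x (by simpa [strip] using hd)
    rw [Complex.ofReal_re] at this
    exact this.trans (le_abs_self _)
  have hP := Real.tsum_eq_tsum_fourier_of_rpow_decay_of_summable hfc one_lt_two hfO hsum (1 / 2)
  have hnf : ∀ s : ℤ, ‖fourier s ((1 / 2 : ℝ) : UnitAddCircle)‖ = 1 := fun s => by
    rw [fourier_apply]; exact Circle.norm_coe _
  set T : ℤ → ℂ := fun s =>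
    FourierTransform.fourier (fun x : ℝ => f x) s * fourier s ((1 / 2 : ℝ) : UnitAddCircle) with hT
  have hTn : ∀ m : ℕ, ∀ s : ℤ, |s| = m → ‖T s‖ ≤ q ^ m * J := fun m s hs => by
    rw [hT]
    simp only [norm_mul, hnf, mul_one]
    exact hF m s hs
  have hTs : Summable T := by
    refine Summable.of_norm ?_
    refine hsum.norm.congr fun s => ?_
    simp only [hT, norm_mul, hnf, mul_one]
  have hT0 : T 0 = ∫ x : ℝ, f x := by
    simp [hT, Real.fourier_real_eq_integral_exp_smul]
  have hS1 : Summable fun m : ℕ => T (m + 1) :=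
    hTs.comp_injective (i := fun m : ℕ => (m + 1 : ℤ)) fun a b h => by simpa using h
  have hS2 : Summable fun m : ℕ => T (-(m + 1)) :=
    hTs.comp_injective (i := fun m : ℕ => (-(m + 1) : ℤ)) fun a b h => by simpa using h
  have hsplit := tsum_of_add_one_of_neg_add_one hS1 hS2
  have hb1 : ‖∑' m : ℕ, T (m + 1)‖ ≤ q / (1 - q) * J :=
    tsum_of_norm_bounded hgeo1 fun m => hTn (m + 1) _ (by
      push_cast; exact abs_of_nonneg (by positivity))
  have hb2 : ‖∑' m : ℕ, T (-(m + 1))‖ ≤ q / (1 - q) * J :=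
    tsum_of_norm_bounded hgeo1 fun m => hTn (m + 1) _ (by
      rw [abs_neg]; push_cast; exact abs_of_nonneg (by positivity))
  have hP' : ∑' k : ℤ, f (((1 / 2 : ℝ) + k : ℝ)) = ∑' s, T s := hP
  rw [hP', hsplit, hT0]
  calc ‖(∫ x : ℝ, f x) - ((∑' m : ℕ, T (m + 1)) + (∫ x : ℝ, f x) + ∑' m : ℕ, T (-(m + 1)))‖
      = ‖(∑' m : ℕ, T (m + 1)) + ∑' m : ℕ, T (-(m + 1))‖ := by
        rw [← norm_neg]; congr 1; ring
    _ ≤ q / (1 - q) * J + q / (1 - q) * J := (norm_add_le _ _).trans (add_le_add hb1 hb2)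
    _ = 2 * J / (Real.exp (2 * Real.pi * d) - 1) := by
        have he : Real.exp (2 * Real.pi * d) = q⁻¹ := by rw [hq, Real.exp_neg, inv_inv]
        have h1 : 1 - q ≠ 0 := by linarith
        have h2 : q⁻¹ - 1 ≠ 0 := by
          have := (one_lt_inv₀ hq0).2 hq1
          linarith
        rw [he]
        field_simp
        ring

/-- The midpoint rule with step `τ` for Hilbert space valued functions, by pairing the error with
itself to reduce to the scalar case. -/
lemma norm_integral_sub_smul_tsum_le {H : Type*} [NormedAddCommGroup H] [InnerProductSpace ℂ H]
    [CompleteSpace H] {g : ℂ → H} {c τ K : ℝ} {G : ℝ → ℝ} (hc : 0 < c) (hτ : 0 < τ)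
    (hg : DifferentiableOn ℂ g (strip c)) (hG : ∀ w ∈ strip c, ‖g w‖ ≤ G w.re)
    (hGK : ∀ x, x ^ 2 * G x ≤ K) (hGi : Integrable G)
    (hGs : Summable fun k : ℤ => G ((1 / 2 + k) * τ)) :
    ‖(∫ x : ℝ, g x) - (τ : ℂ) • ∑' k : ℤ, g (((1 / 2 + k) * τ : ℝ))‖ ≤
      2 * (∫ x, G x) / (Real.exp (2 * Real.pi * c / τ) - 1) := by
  have hre : ∀ x : ℝ, (x : ℂ) ∈ strip c := fun x => by simpa [strip] using hc
  have hGx : ∀ x : ℝ, ‖g x‖ ≤ G x := fun x => by simpa using hG x (hre x)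
  have hG0 : ∀ x, 0 ≤ G x := fun x => (norm_nonneg _).trans (hGx x)
  have hgc : Continuous fun x : ℝ => g x :=
    hg.continuousOn.comp_continuous Complex.continuous_ofReal hre
  have hgi : Integrable fun x : ℝ => g x :=
    hGi.mono' hgc.aestronglyMeasurable (Eventually.of_forall hGx)
  have hgs : Summable fun k : ℤ => g (((1 / 2 + k) * τ : ℝ)) :=
    Summable.of_norm_bounded hGs fun k => hGx _
  set v : H := (∫ x : ℝ, g x) - (τ : ℂ) • ∑' k : ℤ, g (((1 / 2 + k) * τ : ℝ)) with hv
  set f : ℂ → ℂ := fun w => inner ℂ v (g (τ * w)) with hf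
  have hmem : ∀ w ∈ strip (c / τ), (τ : ℂ) * w ∈ strip c := fun w hw => by
    have h1 : |w.im| < c / τ := hw
    rw [lt_div_iff₀ hτ] at h1
    simpa [strip, abs_mul, abs_of_pos hτ, mul_comm] using h1
  have hfd : DifferentiableOn ℂ f (strip (c / τ)) := by
    refine (innerSL ℂ v).differentiable.comp_differentiableOn ?_
    exact hg.comp (Differentiable.differentiableOn (by fun_prop)) hmem
  have hfG : ∀ w ∈ strip (c / τ), ‖f w‖ ≤ ‖v‖ * G (τ * w.re) := fun w hw => by
    refine (norm_inner_le_norm _ _).trans ?_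
    have := hG _ (hmem w hw)
    rw [Complex.re_ofReal_mul] at this
    gcongr
  have hO : (fun x : ℝ => ‖v‖ * G (τ * x)) =O[cocompact ℝ] fun x : ℝ => |x| ^ (-2 : ℝ) := by
    refine Asymptotics.IsBigO.of_bound (‖v‖ * K / τ ^ 2) ?_
    have h0 : ∀ᶠ x : ℝ in cocompact ℝ, x ≠ 0 :=
      (isCompact_singleton (x := (0 : ℝ))).compl_mem_cocompact
    filter_upwards [h0] with x hx
    have h2 : |x| ^ (-2 : ℝ) = (x ^ 2)⁻¹ := by
      rw [Real.rpow_neg (abs_nonneg x), Real.rpow_two, sq_abs]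
    have hx2 : 0 < x ^ 2 := by positivity
    rw [h2, Real.norm_of_nonneg (mul_nonneg (norm_nonneg _) (hG0 _)),
      Real.norm_of_nonneg (by positivity), ← div_eq_mul_inv, div_div, le_div_iff₀ (by positivity)]
    calc ‖v‖ * G (τ * x) * (τ ^ 2 * x ^ 2) = ‖v‖ * ((τ * x) ^ 2 * G (τ * x)) := by ring
      _ ≤ ‖v‖ * K := mul_le_mul_of_nonneg_left (hGK _) (norm_nonneg _)
  have hGi' : Integrable fun x : ℝ => ‖v‖ * G (τ * x) := (hGi.comp_mul_left' hτ.ne').const_mul _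
  have hmain := norm_integral_sub_tsum_le (div_pos hc hτ) hfd hfG hO hGi'
  have e1 : (τ : ℂ) * ∫ x : ℝ, f x = inner ℂ v (∫ x : ℝ, g x) := by
    rw [← integral_inner hgi v]
    have := Measure.integral_comp_mul_left (fun x : ℝ => (inner ℂ v (g x) : ℂ)) τ
    simp only [Complex.ofReal_mul] at this
    rw [hf]
    simp only
    rw [this, abs_of_pos (inv_pos.2 hτ), Complex.real_smul, ← mul_assoc, ← Complex.ofReal_mul,
      mul_inv_cancel₀ hτ.ne', Complex.ofReal_one, one_mul]
  have e2 : ∑' k : ℤ, f (((1 / 2 : ℝ) + k : ℝ)) =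
      inner ℂ v (∑' k : ℤ, g (((1 / 2 + k) * τ : ℝ))) := by
    have := (innerSL ℂ v).map_tsum hgs
    simp only [innerSL_apply_apply] at this
    rw [this]
    refine tsum_congr fun k => ?_
    rw [hf]
    simp only
    congr 2
    push_cast
    ring
  have e3 : ∫ x : ℝ, ‖v‖ * G (τ * x) = τ⁻¹ * (‖v‖ * ∫ x, G x) := by
    rw [integral_const_mul, Measure.integral_comp_mul_left, abs_of_pos (inv_pos.2 hτ), smul_eq_mul]
    ring
  have e4 : ((‖v‖ ^ 2 : ℝ) : ℂ) = τ * ((∫ x : ℝ, f x) - ∑' k : ℤ, f (((1 / 2 : ℝ) + k : ℝ))) := by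
    have : ((‖v‖ ^ 2 : ℝ) : ℂ) = inner ℂ v v := by
      rw [inner_self_eq_norm_sq_to_K]; push_cast; rfl
    rw [this, mul_sub, e1, e2, ← inner_smul_right, ← inner_sub_right]
  have hpos : 0 < Real.exp (2 * Real.pi * (c / τ)) - 1 := by
    rw [sub_pos, Real.one_lt_exp_iff]
    have := Real.pi_pos
    positivity
  have hfin : ‖v‖ ^ 2 ≤ ‖v‖ * (2 * (∫ x, G x) / (Real.exp (2 * Real.pi * (c / τ)) - 1)) := by
    calc ‖v‖ ^ 2 = ‖((‖v‖ ^ 2 : ℝ) : ℂ)‖ := by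
          rw [Complex.norm_real, Real.norm_of_nonneg (by positivity)]
      _ = τ * ‖(∫ x : ℝ, f x) - ∑' k : ℤ, f (((1 / 2 : ℝ) + k : ℝ))‖ := by
          rw [e4, norm_mul, Complex.norm_real, Real.norm_of_nonneg hτ.le]
      _ ≤ τ * (2 * (∫ x : ℝ, ‖v‖ * G (τ * x)) / (Real.exp (2 * Real.pi * (c / τ)) - 1)) := by
          gcongr
      _ = _ := by rw [e3]; field_simp
  rw [mul_div_assoc (2 * Real.pi) c τ]
  rcases (norm_nonneg v).eq_or_lt with h0 | h0
  · rw [← h0]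
    have : 0 ≤ ∫ x, G x := integral_nonneg hG0
    positivity
  · rw [sq] at hfin
    exact le_of_mul_le_mul_left hfin h0

end Quadrature

/-! ### The integrals `∫ exp(-a (cosh x - 1)) dx` -/

section CoshDecay

/-- The decay profile `exp(-a (cosh x - 1))` of the integrand along the hyperbola. -/
def coshDecay (a x : ℝ) : ℝ := Real.exp (-(a * (Real.cosh x - 1)))

lemma coshDecay_pos (a x : ℝ) : 0 < coshDecay a x := Real.exp_pos _

lemma continuous_coshDecay (a : ℝ) : Continuous (coshDecay a) := by
  unfold coshDecay
  fun_prop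

lemma coshDecay_neg (a x : ℝ) : coshDecay a (-x) = coshDecay a x := by
  simp [coshDecay]

lemma coshDecay_le_one {a : ℝ} (ha : 0 ≤ a) (x : ℝ) : coshDecay a x ≤ 1 := by
  rw [coshDecay, Real.exp_le_one_iff]
  have := Real.one_le_cosh x
  nlinarith

lemma coshDecay_anti {a : ℝ} (ha : 0 ≤ a) {x y : ℝ} (hx : 0 ≤ x) (hxy : x ≤ y) :
    coshDecay a y ≤ coshDecay a x := by
  refine Real.exp_le_exp.2 (neg_le_neg (mul_le_mul_of_nonneg_left (sub_le_sub_right ?_ 1) ha))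
  rw [Real.cosh_le_cosh, abs_of_nonneg hx, abs_of_nonneg (hx.trans hxy)]
  exact hxy

lemma sq_div_two_le_cosh_sub_one (x : ℝ) : x ^ 2 / 2 ≤ Real.cosh x - 1 := by
  have h1 : Real.cosh x = 1 + 2 * Real.sinh (x / 2) ^ 2 := by
    have h2 := Real.cosh_two_mul (x / 2)
    rw [Real.cosh_sq, mul_div_cancel₀ x (two_ne_zero)] at h2
    rw [h2]; ring
  have h3 : (x / 2) ^ 2 ≤ Real.sinh (x / 2) ^ 2 := by
    rw [sq_le_sq]
    rcases le_total 0 (x / 2) with h | h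
    · rw [abs_of_nonneg h, abs_of_nonneg (Real.sinh_nonneg_iff.2 h)]
      exact Real.self_le_sinh_iff.2 h
    · rw [abs_of_nonpos h, abs_of_nonpos (Real.sinh_nonpos_iff.2 h)]
      exact neg_le_neg (Real.sinh_le_self_iff.2 h)
  rw [h1]
  nlinarith

lemma integrable_coshDecay {a : ℝ} (ha : 0 < a) : Integrable (coshDecay a) := by
  refine (integrable_exp_neg_mul_sq (half_pos ha)).mono'
    (continuous_coshDecay a).aestronglyMeasurable (Filter.Eventually.of_forall fun x => ?_)
  rw [Real.norm_of_nonneg (coshDecay_pos a x).le]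
  refine Real.exp_le_exp.2 ?_
  nlinarith [sq_div_two_le_cosh_sub_one x]

lemma sq_mul_coshDecay_le {a : ℝ} (ha : 0 < a) (x : ℝ) : x ^ 2 * coshDecay a x ≤ 2 / a := by
  have h1 : a * (x ^ 2 / 2) < Real.exp (a * (Real.cosh x - 1)) := by
    have := Real.add_one_le_exp (a * (Real.cosh x - 1))
    nlinarith [sq_div_two_le_cosh_sub_one x]
  rw [coshDecay, Real.exp_neg, ← div_eq_mul_inv, div_le_div_iff₀ (Real.exp_pos _) ha]
  linarith

lemma one_le_LFun (x : ℝ) : 1 ≤ LFun x := by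
  unfold LFun
  linarith [abs_nonneg (Real.log (1 - Real.exp (-x)))]

/-- The integral grows only logarithmically as `a → 0`: the integrand is at most `1` up to
`|x| ≈ log (1 / a)` and decays double exponentially beyond. -/
lemma integral_coshDecay_le {a : ℝ} (ha : 0 < a) : ∫ x, coshDecay a x ≤ 12 * LFun a := by
  have hq : 0 < 1 - Real.exp (-a) := by
    rw [sub_pos, Real.exp_lt_one_iff]; linarith
  have hq1 : 1 - Real.exp (-a) ≤ 1 := by linarith [Real.exp_pos (-a)]
  set X : ℝ := |Real.log (1 - Real.exp (-a))| with hX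
  have hX0 : 0 ≤ X := abs_nonneg _
  have hXe : 1 ≤ a * Real.exp X := by
    rw [hX, abs_of_nonpos (Real.log_nonpos hq.le hq1), Real.exp_neg, Real.exp_log hq,
      ← div_eq_mul_inv, one_le_div hq]
    linarith [Real.add_one_le_exp (-a)]
  have htail : ∀ x, X + 2 < x → coshDecay a x ≤ Real.exp ((X + 2) / 4) * Real.exp (-1 / 4 * x) := by
    intro x hx
    rw [← Real.exp_add]
    refine Real.exp_le_exp.2 ?_
    have h1 : Real.cosh x ≥ Real.exp x / 2 := by
      rw [Real.cosh_eq]; linarith [Real.exp_pos (-x)]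
    have h2 : 1 + (x - X) ≤ Real.exp (x - X) := by linarith [Real.add_one_le_exp (x - X)]
    have h3 : Real.exp x = Real.exp X * Real.exp (x - X) := by rw [← Real.exp_add]; ring_nf
    have h4 : Real.exp 2 ≤ Real.exp x := Real.exp_le_exp.2 (by linarith)
    have h5 : (4 : ℝ) ≤ Real.exp 2 := by
      have : Real.exp 2 = Real.exp 1 * Real.exp 1 := by rw [← Real.exp_add]; norm_num
      rw [this]
      nlinarith [Real.add_one_le_exp (1 : ℝ)]
    have h6 : Real.exp x / 4 ≤ Real.cosh x - 1 := by linarith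
    have h7 : a * (Real.exp x / 4) ≤ a * (Real.cosh x - 1) := mul_le_mul_of_nonneg_left h6 ha.le
    have h8 : Real.exp (x - X) ≤ a * Real.exp x := by
      rw [h3]
      nlinarith [Real.exp_pos (x - X)]
    linarith
  have hint := integrable_coshDecay ha
  have habs : ∫ x, coshDecay a x = 2 * ∫ x in Ioi (0 : ℝ), coshDecay a x := by
    rw [← integral_comp_abs]
    refine integral_congr_ae (Filter.Eventually.of_forall fun x => ?_)
    rcases abs_cases x with ⟨h, -⟩ | ⟨h, -⟩ <;> simp only [h, coshDecay_neg]
  have hY : (0 : ℝ) ≤ X + 2 := by linarith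
  have hsplit : ∫ x in Ioi (0 : ℝ), coshDecay a x =
      (∫ x in Ioc (0 : ℝ) (X + 2), coshDecay a x) + ∫ x in Ioi (X + 2), coshDecay a x := by
    rw [← setIntegral_union (Ioc_disjoint_Ioi le_rfl) measurableSet_Ioi hint.integrableOn
      hint.integrableOn, Ioc_union_Ioi_eq_Ioi hY]
  have hfirst : ∫ x in Ioc (0 : ℝ) (X + 2), coshDecay a x ≤ X + 2 := by
    have : ∫ x in Ioc (0 : ℝ) (X + 2), coshDecay a x ≤ ∫ x in Ioc (0 : ℝ) (X + 2), (1 : ℝ) :=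
      setIntegral_mono hint.integrableOn (by simp) fun x => coshDecay_le_one ha.le x
    simpa [hY] using this
  have hsecond : ∫ x in Ioi (X + 2), coshDecay a x ≤ 4 := by
    calc ∫ x in Ioi (X + 2), coshDecay a x
        ≤ ∫ x in Ioi (X + 2), Real.exp ((X + 2) / 4) * Real.exp (-1 / 4 * x) := by
          refine setIntegral_mono_on hint.integrableOn
            ((integrableOn_exp_mul_Ioi (by norm_num) _).const_mul _) measurableSet_Ioi
            fun x hx => htail x hx
      _ = 4 := by
          rw [integral_const_mul, integral_exp_mul_Ioi (by norm_num)]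
          have : Real.exp ((X + 2) / 4) * Real.exp (-1 / 4 * (X + 2)) = 1 := by
            rw [← Real.exp_add, Real.exp_eq_one_iff]; ring
          linear_combination 4 * this
  have hL : LFun a = 1 + X := rfl
  rw [habs, hsplit, hL]
  linarith

lemma LFun_half_le {a : ℝ} (ha : 0 < a) : LFun (a / 2) ≤ 2 * LFun a := by
  have h0 : Real.exp (-(a / 2)) < 1 := by rw [Real.exp_lt_one_iff]; linarith
  have h1 : 0 < 1 - Real.exp (-(a / 2)) := by linarith
  have h3 : 0 < 1 + Real.exp (-(a / 2)) := by linarith [Real.exp_pos (-(a / 2))]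
  have h2 : 1 - Real.exp (-a) = (1 - Real.exp (-(a / 2))) * (1 + Real.exp (-(a / 2))) := by
    have : Real.exp (-a) = Real.exp (-(a / 2)) * Real.exp (-(a / 2)) := by
      rw [← Real.exp_add]; ring_nf
    rw [this]; ring
  have h4 : 0 ≤ Real.log (1 + Real.exp (-(a / 2))) :=
    Real.log_nonneg (by linarith [Real.exp_pos (-(a / 2))])
  have h5 : Real.log (1 + Real.exp (-(a / 2))) ≤ 1 := by
    have := Real.log_le_sub_one_of_pos h3
    linarith
  have h6 : Real.log (1 - Real.exp (-(a / 2))) ≤ 0 :=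
    Real.log_nonpos h1.le (by linarith [Real.exp_pos (-(a / 2))])
  unfold LFun
  rw [h2, Real.log_mul h1.ne' h3.ne', abs_of_nonpos h6]
  have := neg_abs_le (Real.log (1 - Real.exp (-(a / 2))) + Real.log (1 + Real.exp (-(a / 2))))
  have := abs_nonneg (Real.log (1 - Real.exp (-(a / 2))) + Real.log (1 + Real.exp (-(a / 2))))
  linarith

/-- A monotone profile is dominated at each midpoint by twice its mean over the left half of the
cell, so that midpoint sums are at most twice the integral. -/
lemma sum_coshDecay_le {a τ : ℝ} (ha : 0 < a) (hτ : 0 < τ) (n : ℕ) :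
    ∑ j ∈ Finset.range n, τ * coshDecay a ((j + 1 / 2) * τ) ≤ 2 * ∫ x, coshDecay a x := by
  have hint := integrable_coshDecay ha
  have hii : ∀ u v : ℝ, IntervalIntegrable (coshDecay a) volume u v := fun u v =>
    (continuous_coshDecay a).intervalIntegrable u v
  have hterm : ∀ j : ℕ, τ * coshDecay a ((j + 1 / 2) * τ) ≤
      2 * ∫ x in (j * τ)..((j + 1 : ℕ) * τ), coshDecay a x := by
    intro j
    have hj : (0 : ℝ) ≤ j * τ := by positivity
    have h1 : (τ / 2) * coshDecay a ((j + 1 / 2) * τ) ≤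
        ∫ x in (j * τ)..((j + 1 / 2) * τ), coshDecay a x := by
      have := intervalIntegral.integral_mono_on (a := j * τ) (b := (j + 1 / 2) * τ)
        (f := fun _ => coshDecay a ((j + 1 / 2) * τ)) (g := coshDecay a) (μ := volume)
        (by nlinarith) (by simp) (hii _ _)
        fun x hx => coshDecay_anti ha.le (hj.trans hx.1) hx.2
      rw [intervalIntegral.integral_const, smul_eq_mul] at this
      convert this using 2
      ring
    have h2 : 0 ≤ ∫ x in ((j + 1 / 2) * τ)..((j + 1 : ℕ) * τ), coshDecay a x :=
      intervalIntegral.integral_nonneg (by push_cast; nlinarith) fun x _ => (coshDecay_pos a x).le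
    rw [← intervalIntegral.integral_add_adjacent_intervals (hii _ ((j + 1 / 2) * τ)) (hii _ _)]
    linarith
  calc ∑ j ∈ Finset.range n, τ * coshDecay a ((j + 1 / 2) * τ)
      ≤ ∑ j ∈ Finset.range n, 2 * ∫ x in (j * τ)..((j + 1 : ℕ) * τ), coshDecay a x :=
        Finset.sum_le_sum fun j _ => hterm j
    _ = 2 * ∫ x in (((0 : ℕ) : ℝ) * τ)..((n : ℕ) * τ), coshDecay a x := by
        rw [← Finset.mul_sum, intervalIntegral.sum_integral_adjacent_intervals
          (a := fun j : ℕ => (j : ℝ) * τ) fun k _ => hii _ _]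
    _ ≤ 2 * ∫ x, coshDecay a x := by
        rw [intervalIntegral.integral_of_le (by simp; positivity)]
        have := setIntegral_le_integral (s := Ioc (((0 : ℕ) : ℝ) * τ) ((n : ℕ) * τ)) hint
          (Filter.Eventually.of_forall fun x => (coshDecay_pos a x).le)
        linarith

lemma sum_coshDecay_le_LFun {a τ : ℝ} (ha : 0 < a) (hτ : 0 < τ) (n : ℕ) :
    ∑ j ∈ Finset.range n, τ * coshDecay a ((j + 1 / 2) * τ) ≤ 24 * LFun a := by
  linarith [sum_coshDecay_le ha hτ n, integral_coshDecay_le ha]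

lemma summable_coshDecay {a τ : ℝ} (ha : 0 < a) (hτ : 0 < τ) :
    Summable fun k : ℤ => coshDecay a ((1 / 2 + k) * τ) := by
  have h : Summable fun j : ℕ => τ * coshDecay a ((j + 1 / 2) * τ) :=
    summable_of_sum_range_le (fun j => (mul_pos hτ (coshDecay_pos _ _)).le)
      (sum_coshDecay_le ha hτ)
  have h' : Summable fun j : ℕ => coshDecay a ((j + 1 / 2) * τ) :=
    (summable_mul_left_iff hτ.ne').1 h
  refine Summable.of_nat_of_neg_add_one ?_ ?_
  · refine h'.congr fun j => ?_
    push_cast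
    ring_nf
  · refine h'.congr fun j => ?_
    rw [← coshDecay_neg]
    push_cast
    ring_nf

end CoshDecay

/-! ### Geometry of the hyperbolic contour -/

section Contour

variable {θ μ : ℝ}

lemma sin_I_mul_sub (φ : ℂ) :
    Complex.sin (Complex.I * φ - θ) = ((-(Real.sin (θ + φ.im) * Real.cosh φ.re) : ℝ) : ℂ) +
      (Real.cos (θ + φ.im) * Real.sinh φ.re : ℝ) * Complex.I := by
  rw [Complex.sin_eq]
  have h1 : (Complex.I * φ - θ).re = -(θ + φ.im) := by simp; ring
  have h2 : (Complex.I * φ - θ).im = φ.re := by simp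
  rw [h1, h2]
  push_cast
  rw [Complex.sin_neg, Complex.cos_neg]
  ring

lemma contour_re (φ : ℂ) :
    (contour θ μ φ).re = μ * (1 - Real.sin (θ + φ.im) * Real.cosh φ.re) := by
  rw [contour, sin_I_mul_sub, Complex.re_ofReal_mul, Complex.add_re, Complex.add_re,
    Complex.ofReal_re, Complex.re_ofReal_mul, Complex.one_re, Complex.I_re]
  ring

lemma contour_im (φ : ℂ) :
    (contour θ μ φ).im = μ * (Real.cos (θ + φ.im) * Real.sinh φ.re) := by
  rw [contour, sin_I_mul_sub, Complex.im_ofReal_mul, Complex.add_im, Complex.add_im,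
    Complex.ofReal_im, Complex.im_ofReal_mul, Complex.one_im, Complex.I_im]
  ring

lemma norm_contour (hμ : 0 < μ) (φ : ℂ) :
    ‖contour θ μ φ‖ = μ * (Real.cosh φ.re - Real.sin (θ + φ.im)) := by
  have h0 : 0 ≤ μ * (Real.cosh φ.re - Real.sin (θ + φ.im)) :=
    mul_nonneg hμ.le (by linarith [Real.one_le_cosh φ.re, Real.sin_le_one (θ + φ.im)])
  rw [← sq_eq_sq₀ (norm_nonneg _) h0, ← Complex.normSq_eq_norm_sq, Complex.normSq_apply,
    contour_re, contour_im]
  have h1 := Real.cosh_sq φ.re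
  have h2 := Real.sin_sq_add_cos_sq (θ + φ.im)
  linear_combination (-μ ^ 2 * Real.cos (θ + φ.im) ^ 2) * h1 +
    (μ ^ 2 * Real.cosh φ.re ^ 2 - μ ^ 2) * h2

lemma hasDerivAt_contour (φ : ℂ) :
    HasDerivAt (contour θ μ) (μ * (Complex.cos (Complex.I * φ - θ) * Complex.I)) φ := by
  have h1 : HasDerivAt (fun φ : ℂ => Complex.I * φ - θ) Complex.I φ := by
    simpa using ((hasDerivAt_id φ).const_mul Complex.I).sub_const (θ : ℂ)
  exact (((Complex.hasDerivAt_sin _).comp φ h1).const_add 1).const_mul (μ : ℂ)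

lemma deriv_contour :
    deriv (contour θ μ) = fun φ => μ * (Complex.cos (Complex.I * φ - θ) * Complex.I) :=
  funext fun φ => (hasDerivAt_contour φ).deriv

lemma norm_deriv_contour_sq (φ : ℂ) :
    ‖deriv (contour θ μ) φ‖ ^ 2 =
      μ ^ 2 * ((Real.cosh φ.re - Real.sin (θ + φ.im)) * (Real.cosh φ.re + Real.sin (θ + φ.im))) := by
  have h : Complex.cos (Complex.I * φ - θ) = (Real.cos (θ + φ.im) * Real.cosh φ.re : ℝ) +
      (Real.sin (θ + φ.im) * Real.sinh φ.re : ℝ) * Complex.I := by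
    rw [Complex.cos_eq]
    have h1 : (Complex.I * φ - θ).re = -(θ + φ.im) := by simp; ring
    have h2 : (Complex.I * φ - θ).im = φ.re := by simp
    rw [h1, h2]
    push_cast
    rw [Complex.sin_neg, Complex.cos_neg]
    ring
  rw [deriv_contour]
  simp only
  rw [h, ← Complex.normSq_eq_norm_sq, map_mul, map_mul, Complex.normSq_add_mul_I,
    Complex.normSq_ofReal, Complex.normSq_I]
  have h1 := Real.cosh_sq φ.re
  have h2 := Real.sin_sq_add_cos_sq (θ + φ.im)
  linear_combination (-μ ^ 2 * Real.sin (θ + φ.im) ^ 2) * h1 +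
    (μ ^ 2 * Real.cosh φ.re ^ 2) * h2

/-- `|z'| ≤ φ(θ,c) |z|` on the closed strip. -/
lemma norm_deriv_contour_le (hμ : 0 < μ) {c : ℝ} {φ : ℂ}
    (h0 : 0 ≤ Real.sin (θ + φ.im)) (hle : Real.sin (θ + φ.im) ≤ Real.sin (θ + c))
    (hlt : Real.sin (θ + c) < 1) :
    ‖deriv (contour θ μ) φ‖ ≤ phiFactor θ c * ‖contour θ μ φ‖ := by
  set s := Real.sin (θ + φ.im) with hs
  set S := Real.sin (θ + c) with hS
  have hch := Real.one_le_cosh φ.re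
  rw [norm_contour hμ, phiFactor, ← hs, ← hS]
  have hq : 0 ≤ (1 + S) / (1 - S) := div_nonneg (by linarith) (by linarith)
  refine le_of_sq_le_sq ?_ (mul_nonneg (Real.sqrt_nonneg _) (mul_nonneg hμ.le (by linarith)))
  rw [norm_deriv_contour_sq, mul_pow, Real.sq_sqrt hq, ← hs]
  have key : Real.cosh φ.re + s ≤ (1 + S) / (1 - S) * (Real.cosh φ.re - s) := by
    rw [div_mul_eq_mul_div, le_div_iff₀ (by linarith)]
    nlinarith
  have : μ ^ 2 * ((Real.cosh φ.re - s) * (Real.cosh φ.re + s)) ≤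
      μ ^ 2 * ((Real.cosh φ.re - s) * ((1 + S) / (1 - S) * (Real.cosh φ.re - s))) := by
    have h1 : 0 ≤ Real.cosh φ.re - s := by linarith
    gcongr
  linarith

lemma contour_ne_zero (hμ : 0 < μ) {φ : ℂ} (hlt : Real.sin (θ + φ.im) < 1) :
    contour θ μ φ ≠ 0 := by
  rw [← norm_pos_iff, norm_contour hμ]
  exact mul_pos hμ (by linarith [Real.one_le_cosh φ.re])

/-- The branch of the hyperbola through the line `Im φ = y` stays inside its asymptotes, of
argument `±(π / 2 + θ + y)`. -/
lemma abs_arg_contour_lt (hμ : 0 < μ) {φ : ℂ} (h0 : 0 ≤ θ + φ.im) (h1 : θ + φ.im < Real.pi / 2) :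
    |(contour θ μ φ).arg| < Real.pi / 2 + (θ + φ.im) := by
  have hslt : Real.sin (θ + φ.im) < 1 := by
    rw [← Real.sin_pi_div_two]
    exact Real.sin_lt_sin_of_lt_of_le_pi_div_two (by linarith [Real.pi_pos]) le_rfl h1
  have hs0 : 0 ≤ Real.sin (θ + φ.im) := Real.sin_nonneg_of_nonneg_of_le_pi h0 (by linarith)
  have hne := contour_ne_zero hμ hslt
  have hlt : Real.cos (Real.pi / 2 + (θ + φ.im)) < Real.cos |(contour θ μ φ).arg| := by
    rw [Real.cos_abs, Complex.cos_arg hne, lt_div_iff₀ (norm_pos_iff.2 hne), norm_contour hμ,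
      contour_re, add_comm (Real.pi / 2), Real.cos_add_pi_div_two]
    nlinarith [mul_pos hμ (show 0 < 1 - Real.sin (θ + φ.im) ^ 2 by nlinarith)]
  by_contra hcon
  rw [not_lt] at hcon
  exact absurd hlt (not_lt.2 (Real.cos_le_cos_of_nonneg_of_le_pi (by linarith [Real.pi_pos])
    (Complex.abs_arg_le_pi _) hcon))

lemma contour_neg_ofReal (x : ℝ) : contour θ μ ((-x : ℝ) : ℂ) = conj (contour θ μ (x : ℂ)) := by
  apply Complex.ext
  · simp [contour_re]
  · simp [contour_im]

lemma deriv_contour_neg_ofReal (x : ℝ) :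
    deriv (contour θ μ) ((-x : ℝ) : ℂ) = -conj (deriv (contour θ μ) (x : ℂ)) := by
  rw [deriv_contour]
  simp only [map_mul, Complex.conj_ofReal, ← Complex.cos_conj, map_sub, Complex.conj_I]
  have : Complex.I * ((-x : ℝ) : ℂ) - θ = -Complex.I * (x : ℂ) - θ := by push_cast; ring
  rw [this]
  ring

end Contour

/-! ### The symbol `m` -/

section Symbol

variable {α β γ : ℝ} {z : ℂ}

lemma cpow_ofReal_eq_exp (hz : z ≠ 0) (s : ℝ) :
    z ^ (s : ℂ) = Complex.exp (s * Real.log ‖z‖ + (s * z.arg : ℝ) * Complex.I) := by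
  rw [Complex.cpow_def_of_ne_zero hz, Complex.log]
  congr 1
  push_cast
  ring

lemma cpow_add_one_ne_zero (hz : z ≠ 0) (h : |α * z.arg| < Real.pi) : z ^ (α : ℂ) + 1 ≠ 0 := by
  intro h0
  -- rotating by half the argument of `z ^ α` moves both terms into the right half-plane
  have h1 : (Complex.exp (((-(α * z.arg / 2) : ℝ) : ℂ) * Complex.I) *
      (z ^ (α : ℂ) + 1)).re = 0 := by
    rw [h0, mul_zero, Complex.zero_re]
  rw [mul_add, mul_one, cpow_ofReal_eq_exp hz, ← Complex.exp_add, Complex.add_re, Complex.exp_re,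
    Complex.exp_ofReal_mul_I_re, ← Complex.ofReal_mul] at h1
  have e1 : (((-(α * z.arg / 2) : ℝ) : ℂ) * Complex.I + (((α * Real.log ‖z‖ : ℝ) : ℂ) +
      ((α * z.arg : ℝ) : ℂ) * Complex.I)).im = α * z.arg / 2 := by
    simp only [Complex.add_im, Complex.im_ofReal_mul, Complex.I_im, Complex.ofReal_im]
    ring
  rw [e1, Real.cos_neg] at h1
  have h2 : 0 < Real.cos (α * z.arg / 2) := by
    rw [abs_lt] at h
    exact Real.cos_pos_of_mem_Ioo ⟨by linarith [h.1], by linarith [h.2]⟩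
  nlinarith [Real.exp_pos (((-(α * z.arg / 2) : ℝ) : ℂ) * Complex.I +
    (((α * Real.log ‖z‖ : ℝ) : ℂ) + ((α * z.arg : ℝ) : ℂ) * Complex.I)).re]

lemma inv_mFun (hz : z ≠ 0) :
    (mFun α β z)⁻¹ = z ^ ((-β : ℝ) : ℂ) + z ^ ((-(α + β) : ℝ) : ℂ) := by
  have h1 : z ^ ((α + β : ℝ) : ℂ) = z ^ (α : ℂ) * z ^ (β : ℂ) := by
    rw [← Complex.cpow_add _ _ hz]; push_cast; rfl
  have h2 : z ^ (α : ℂ) ≠ 0 := by simp [Complex.cpow_eq_zero_iff, hz]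
  have h3 : z ^ (β : ℂ) ≠ 0 := by simp [Complex.cpow_eq_zero_iff, hz]
  unfold mFun
  rw [Complex.ofReal_neg, Complex.ofReal_neg, Complex.cpow_neg, Complex.cpow_neg, h1, inv_div]
  field_simp

/-- `1 / m(z) = z ^ (-β) + z ^ (-(α + β))`, and the arguments of `1`, `z ^ (-β)` and
`z ^ (-(α + β))` all lie between `0` and `-(α + β) arg z`: rotation by half of the largest such
angle moves the three of them into the right half-plane. -/
lemma isSectorial_mFun (hα : 0 ≤ α) (hβ : 0 ≤ β) (hz : z ≠ 0) (hγ : γ < Real.pi / 2)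
    (h : (α + β) * |z.arg| ≤ 2 * γ) : IsSectorial (Real.cos γ) (mFun α β z) := by
  have hαarg : |α * z.arg| < Real.pi := by
    rw [abs_mul, abs_of_nonneg hα]
    nlinarith [abs_nonneg z.arg]
  have hγ0 : 0 ≤ γ := by nlinarith [abs_nonneg z.arg]
  have hm : mFun α β z ≠ 0 := by
    unfold mFun
    exact div_ne_zero (by simp [Complex.cpow_eq_zero_iff, hz]) (cpow_add_one_ne_zero hz hαarg)
  obtain ⟨γ', hγ'1, hγ'2⟩ : ∃ γ' : ℝ, Real.cos γ' = Real.cos γ ∧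
      ∀ s, 0 ≤ s → s ≤ α + β → |γ' - s * z.arg| ≤ γ := by
    rcases le_total 0 z.arg with hw | hw
    · refine ⟨γ, rfl, fun s hs hs' => ?_⟩
      rw [abs_of_nonneg hw] at h
      rw [abs_le]
      constructor <;> nlinarith [mul_nonneg hs hw]
    · refine ⟨-γ, Real.cos_neg γ, fun s hs hs' => ?_⟩
      rw [abs_of_nonpos hw] at h
      rw [abs_le]
      constructor <;> nlinarith [mul_nonneg hs (neg_nonneg.2 hw)]
  refine ⟨hm, Complex.exp (γ' * Complex.I), Complex.norm_exp_ofReal_mul_I γ', ?_, ?_⟩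
  · rw [Complex.exp_ofReal_mul_I_re, hγ'1]
  · have hterm : ∀ s, 0 ≤ s → s ≤ α + β →
        0 ≤ (Complex.exp (γ' * Complex.I) * z ^ ((-s : ℝ) : ℂ)).re := by
      intro s hs hs'
      rw [cpow_ofReal_eq_exp hz, ← Complex.exp_add, ← Complex.ofReal_mul, Complex.exp_re]
      have e1 : ((γ' : ℂ) * Complex.I + (((-s * Real.log ‖z‖ : ℝ) : ℂ) +
          ((-s * z.arg : ℝ) : ℂ) * Complex.I)).im = γ' - s * z.arg := by
        simp only [Complex.add_im, Complex.im_ofReal_mul, Complex.I_im, Complex.ofReal_im]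
        ring
      rw [e1]
      have := abs_le.1 (hγ'2 s hs hs')
      exact mul_nonneg (Real.exp_pos _).le
        (Real.cos_nonneg_of_mem_Icc ⟨by linarith [this.1], by linarith [this.2]⟩)
    rw [div_eq_mul_inv, inv_mFun hz, mul_add, Complex.add_re]
    exact add_nonneg (hterm β hβ (by linarith)) (hterm (α + β) (by linarith) le_rfl)

lemma mFun_conj (hz : z ∈ Complex.slitPlane) : mFun α β (conj z) = conj (mFun α β z) := by
  have h := (Complex.mem_slitPlane_iff_arg.1 hz).1
  unfold mFun
  rw [Complex.conj_cpow _ _ h, Complex.conj_cpow _ _ h, map_div₀, map_add, map_one,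
    Complex.conj_ofReal, Complex.conj_ofReal]

lemma differentiableAt_mFun (hz : z ∈ Complex.slitPlane) (h : z ^ (α : ℂ) + 1 ≠ 0) :
    DifferentiableAt ℂ (mFun α β) z := by
  unfold mFun
  refine DifferentiableAt.div ?_ ?_ h
  · exact differentiableAt_id.cpow_const hz
  · exact (differentiableAt_id.cpow_const hz).add_const 1

end Symbol

/-! ### The integrand on the strip -/

section Integrand

/-- The conditions on the parameters under which the strip is mapped into a sector where the
resolvent bound holds uniformly: `mFun α β` has argument at most `(α + β + ε) π / 2 < π` there. -/
structure Admissible (α β ε θ c μ : ℝ) : Prop where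
  α_pos : 0 < α
  β_pos : 0 < β
  β_le_one : β ≤ 1
  add_lt_two : α + β + ε < 2
  c_pos : 0 < c
  c_lt : c < θ
  add_lt_pi_div_two : θ + c < Real.pi / 2
  angle_le : (α + β) * (θ + c) ≤ ε * Real.pi / 2
  μ_pos : 0 < μ

/-- The constant `κ` of the resolvent bound: the cosine of half of `(α + β + ε) π / 2`, the bound on
the argument of `mFun α β` over the strip. -/
def sectorConst (α β ε : ℝ) : ℝ := Real.cos ((α + β + ε) * Real.pi / 4)

variable {α β ε θ c μ : ℝ} {n : ℕ} {Ω : Set (E n)}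

namespace Admissible

variable (H : Admissible α β ε θ c μ)

include H

lemma sin_sub_pos : 0 < Real.sin (θ - c) :=
  Real.sin_pos_of_pos_of_lt_pi (by linarith [H.c_lt]) (by
    linarith [H.add_lt_pi_div_two, H.c_pos, Real.pi_pos])

lemma sin_sub_lt_sin : Real.sin (θ - c) < Real.sin θ :=
  Real.sin_lt_sin_of_lt_of_le_pi_div_two (by linarith [H.c_lt, Real.pi_pos])
    (by linarith [H.add_lt_pi_div_two, H.c_pos]) (by linarith [H.c_pos])

lemma sin_add_lt_one : Real.sin (θ + c) < 1 := by
  rw [← Real.sin_pi_div_two]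
  exact Real.sin_lt_sin_of_lt_of_le_pi_div_two
    (by linarith [H.c_lt, H.c_pos, Real.pi_pos]) le_rfl H.add_lt_pi_div_two

lemma sin_mem {φ : ℂ} (hφ : φ ∈ strip c) :
    Real.sin (θ - c) ≤ Real.sin (θ + φ.im) ∧ Real.sin (θ + φ.im) ≤ Real.sin (θ + c) := by
  obtain ⟨h1, h2⟩ := abs_lt.1 (show |φ.im| < c from hφ)
  have := H.c_lt
  have := H.c_pos
  have := H.add_lt_pi_div_two
  have := Real.pi_pos
  constructor <;> apply Real.sin_le_sin_of_le_of_le_pi_div_two <;> linarith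

lemma contour_ne_zero {φ : ℂ} (hφ : φ ∈ strip c) : contour θ μ φ ≠ 0 :=
  CIM.contour_ne_zero H.μ_pos ((H.sin_mem hφ).2.trans_lt H.sin_add_lt_one)

lemma abs_arg_lt {φ : ℂ} (hφ : φ ∈ strip c) : |(contour θ μ φ).arg| < Real.pi / 2 + (θ + c) := by
  obtain ⟨h1, h2⟩ := abs_lt.1 (show |φ.im| < c from hφ)
  have := H.c_lt
  have := H.add_lt_pi_div_two
  have h3 := abs_arg_contour_lt (θ := θ) H.μ_pos (φ := φ) (by linarith) (by linarith)
  linarith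

lemma contour_mem_slitPlane {φ : ℂ} (hφ : φ ∈ strip c) : contour θ μ φ ∈ Complex.slitPlane := by
  rw [Complex.mem_slitPlane_iff_arg]
  refine ⟨fun h => ?_, H.contour_ne_zero hφ⟩
  have h1 := H.abs_arg_lt hφ
  rw [h, abs_of_pos Real.pi_pos] at h1
  linarith [H.add_lt_pi_div_two]

lemma add_mul_abs_arg_le {φ : ℂ} (hφ : φ ∈ strip c) :
    (α + β) * |(contour θ μ φ).arg| ≤ 2 * ((α + β + ε) * Real.pi / 4) := by
  have h1 := mul_le_mul_of_nonneg_left (H.abs_arg_lt hφ).le (by linarith [H.α_pos, H.β_pos] :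
    0 ≤ α + β)
  linarith [H.angle_le]

lemma half_angle_lt : (α + β + ε) * Real.pi / 4 < Real.pi / 2 := by
  nlinarith [H.add_lt_two, Real.pi_pos]

lemma isSectorial {φ : ℂ} (hφ : φ ∈ strip c) :
    IsSectorial (sectorConst α β ε) (mFun α β (contour θ μ φ)) :=
  isSectorial_mFun H.α_pos.le H.β_pos.le (H.contour_ne_zero hφ) H.half_angle_lt
    (H.add_mul_abs_arg_le hφ)

lemma sectorConst_pos : 0 < sectorConst α β ε := by
  refine Real.cos_pos_of_mem_Ioo ⟨?_, H.half_angle_lt⟩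
  have h : (0 : ℂ) ∈ strip c := by simpa [strip] using H.c_pos
  have := H.add_mul_abs_arg_le h
  have h2 : 0 ≤ (α + β) * |(contour θ μ 0).arg| :=
    mul_nonneg (by linarith [H.α_pos, H.β_pos]) (abs_nonneg _)
  linarith [Real.pi_pos]

lemma mFun_mem_slitPlane {φ : ℂ} (hφ : φ ∈ strip c) :
    mFun α β (contour θ μ φ) ∈ Complex.slitPlane :=
  (H.isSectorial hφ).mem_slitPlane H.sectorConst_pos

lemma differentiableAt_mFun {φ : ℂ} (hφ : φ ∈ strip c) :
    DifferentiableAt ℂ (mFun α β) (contour θ μ φ) := by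
  refine CIM.differentiableAt_mFun (H.contour_mem_slitPlane hφ)
    (cpow_add_one_ne_zero (H.contour_ne_zero hφ) ?_)
  rw [abs_mul, abs_of_pos H.α_pos]
  have h1 := H.add_mul_abs_arg_le hφ
  have h2 := mul_nonneg H.β_pos.le (abs_nonneg (contour θ μ φ).arg)
  linarith [H.half_angle_lt]

lemma differentiableOn_integrand (u₀ : L2R Ω) {F : ℂ → L2C Ω} (t : ℝ)
    (hF : ∀ φ ∈ strip c, DifferentiableAt ℂ F (contour θ μ φ)) :
    DifferentiableOn ℂ (integrand Ω α β θ μ u₀ F t) (strip c) := by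
  intro φ hφ
  refine DifferentiableAt.differentiableWithinAt ?_
  have hz : DifferentiableAt ℂ (contour θ μ) φ := (hasDerivAt_contour φ).differentiableAt
  have hm := H.differentiableAt_mFun hφ
  have hsl := H.contour_mem_slitPlane hφ
  have hz0 := H.contour_ne_zero hφ
  have hu : DifferentiableAt ℂ (uHat Ω α β u₀ F) (contour θ μ φ) := by
    refine differentiableAt_resolvent hm (DifferentiableAt.add ?_ ?_) (H.mFun_mem_slitPlane hφ)
    · exact (hm.fun_div differentiableAt_fun_id hz0).smul_const (toC u₀)
    · have hd : DifferentiableAt ℂ (fun z => mFun α β z / z ^ (β : ℂ)) (contour θ μ φ) :=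
        hm.fun_div (differentiableAt_fun_id.cpow_const hsl)
          (by simp [Complex.cpow_eq_zero_iff, hz0])
      exact hd.smul (hF φ hφ)
  unfold integrand
  rw [deriv_contour]
  have hd : DifferentiableAt ℂ (fun φ : ℂ => (2 * Real.pi * Complex.I : ℂ)⁻¹ *
      Complex.exp (contour θ μ φ * t) *
      (μ * (Complex.cos (Complex.I * φ - θ) * Complex.I))) φ := by fun_prop
  exact hd.smul (hu.comp φ hz)

lemma norm_uHat_le (u₀ : L2R Ω) {F : ℂ → L2C Ω} {B : ℝ} {φ : ℂ} (hφ : φ ∈ strip c)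
    (hB : ‖F (contour θ μ φ)‖ ≤ B) :
    ‖uHat Ω α β u₀ F (contour θ μ φ)‖ ≤ (sectorConst α β ε)⁻¹ *
      (‖u₀‖ / ‖contour θ μ φ‖ + B / ‖contour θ μ φ‖ ^ β) := by
  set z := contour θ μ φ with hz
  have hz0 : 0 < ‖z‖ := norm_pos_iff.2 (H.contour_ne_zero hφ)
  have hm0 : 0 < ‖mFun α β z‖ := norm_pos_iff.2 (H.isSectorial hφ).1
  have hκ := H.sectorConst_pos
  refine (norm_resolvent_le hκ (H.isSectorial hφ) _).trans ?_
  have h1 : ‖(mFun α β z / z) • toC u₀ + (mFun α β z / z ^ (β : ℂ)) • F z‖ ≤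
      ‖mFun α β z‖ * (‖u₀‖ / ‖z‖ + B / ‖z‖ ^ β) := by
    refine (norm_add_le _ _).trans ?_
    rw [norm_smul, norm_smul, norm_div, norm_div, Complex.norm_cpow_real, mul_add]
    refine add_le_add ?_ ?_
    · rw [div_mul_eq_mul_div, mul_div_assoc]
      gcongr
      exact norm_toC_le u₀
    · rw [div_mul_eq_mul_div, mul_div_assoc]
      gcongr
  calc _ ≤ ‖mFun α β z‖ * (‖u₀‖ / ‖z‖ + B / ‖z‖ ^ β) / (sectorConst α β ε * ‖mFun α β z‖) := by
        gcongr
    _ = _ := by field_simp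

/-- The factor `|z'| |z|⁻¹` is bounded by `φ(θ,c)`; the source contributes a further factor
`|z| ^ (1 - β)`, which is bounded crudely by `1 + μ cosh x`. -/
lemma norm_integrand_le (u₀ : L2R Ω) {F : ℂ → L2C Ω} {B : ℝ} (t : ℝ) {φ : ℂ} (hφ : φ ∈ strip c)
    (hB : ‖F (contour θ μ φ)‖ ≤ B) :
    ‖integrand Ω α β θ μ u₀ F t φ‖ ≤ (2 * Real.pi * sectorConst α β ε)⁻¹ * phiFactor θ c *
      (Real.exp ((contour θ μ φ).re * t) * (‖u₀‖ + B * (1 + μ * Real.cosh φ.re))) := by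
  have hu := H.norm_uHat_le u₀ hφ hB
  have hsin := H.sin_mem hφ
  have hs0 : 0 ≤ Real.sin (θ + φ.im) := H.sin_sub_pos.le.trans hsin.1
  have hd := norm_deriv_contour_le H.μ_pos hs0 hsin.2 H.sin_add_lt_one
  have hzn : ‖contour θ μ φ‖ ≤ μ * Real.cosh φ.re := by
    rw [norm_contour H.μ_pos]
    exact mul_le_mul_of_nonneg_left (by linarith) H.μ_pos.le
  have hz0 : 0 < ‖contour θ μ φ‖ := norm_pos_iff.2 (H.contour_ne_zero hφ)
  have hκ := H.sectorConst_pos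
  have hB0 : 0 ≤ B := (norm_nonneg _).trans hB
  have hφ0 : 0 ≤ phiFactor θ c := Real.sqrt_nonneg _
  set r := ‖contour θ μ φ‖ with hr
  have hpow : r / r ^ β ≤ 1 + r := by
    rw [div_le_iff₀ (Real.rpow_pos_of_pos hz0 β)]
    rcases le_total r 1 with h | h
    · have : r ^ (1 : ℝ) ≤ r ^ β := Real.rpow_le_rpow_of_exponent_ge hz0 h H.β_le_one
      rw [Real.rpow_one] at this
      nlinarith [Real.rpow_pos_of_pos hz0 β]
    · have := Real.one_le_rpow h H.β_pos.le
      nlinarith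
  have hpi := Real.pi_pos
  have hexp : ‖Complex.exp (contour θ μ φ * t)‖ = Real.exp ((contour θ μ φ).re * t) := by
    rw [Complex.norm_exp, Complex.re_mul_ofReal]
  have h2pi : ‖(2 * Real.pi * Complex.I : ℂ)⁻¹‖ = (2 * Real.pi)⁻¹ := by
    simp [abs_of_pos hpi]
  unfold integrand
  rw [norm_smul, norm_mul, norm_mul, hexp, h2pi]
  calc (2 * Real.pi)⁻¹ * Real.exp ((contour θ μ φ).re * t) * ‖deriv (contour θ μ) φ‖ *
        ‖uHat Ω α β u₀ F (contour θ μ φ)‖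
      ≤ (2 * Real.pi)⁻¹ * Real.exp ((contour θ μ φ).re * t) * (phiFactor θ c * r) *
        ((sectorConst α β ε)⁻¹ * (‖u₀‖ / r + B / r ^ β)) := by gcongr
    _ = (2 * Real.pi * sectorConst α β ε)⁻¹ * phiFactor θ c *
        (Real.exp ((contour θ μ φ).re * t) * (‖u₀‖ + B * (r / r ^ β))) := by field_simp
    _ ≤ _ := by
        gcongr
        exact hpow.trans (by linarith)

omit H in
lemma one_add_mul_exp_neg_le {δ y : ℝ} (hδ : 0 < δ) (hy : 0 ≤ y) :
    (1 + y) * Real.exp (-(δ * y)) ≤ 1 + 1 / δ := by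
  have h1 : δ * y + 1 ≤ Real.exp (δ * y) := Real.add_one_le_exp _
  rw [Real.exp_neg, ← div_eq_mul_inv, div_le_iff₀ (Real.exp_pos _)]
  have h2 : (1 + 1 / δ) * (δ * y + 1) = 1 + y + (δ * y + 1 / δ) := by field_simp; ring
  have h3 : 0 ≤ δ * y + 1 / δ := by positivity
  have h4 : 0 < 1 + 1 / δ := by positivity
  nlinarith

/-- A uniform majorant of the integrand on the strip. Half of the decay rate
`a = μ t₀ sin (θ - c)` absorbs the growth `1 + μ cosh x` of the source contribution. -/
lemma norm_integrand_le_coshDecay (u₀ : L2R Ω) {F : ℂ → L2C Ω} {B t₀ t T : ℝ} (ht₀ : 0 < t₀)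
    (ht : t₀ ≤ t) (htT : t ≤ T) {φ : ℂ} (hφ : φ ∈ strip c) (hB : ‖F (contour θ μ φ)‖ ≤ B) :
    ‖integrand Ω α β θ μ u₀ F t φ‖ ≤ (2 * Real.pi * sectorConst α β ε)⁻¹ * phiFactor θ c *
      Real.exp (μ * T) * (‖u₀‖ * coshDecay (μ * t₀ * Real.sin (θ - c)) φ.re +
        B * (1 + 2 / (t₀ * Real.sin (θ - c))) *
          coshDecay (μ * t₀ * Real.sin (θ - c) / 2) φ.re) := by
  refine (H.norm_integrand_le u₀ t hφ hB).trans ?_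
  have hs := H.sin_sub_pos
  have hμ := H.μ_pos
  have hκ := H.sectorConst_pos
  have hpi := Real.pi_pos
  have hB0 : 0 ≤ B := (norm_nonneg _).trans hB
  have hφ0 : 0 ≤ phiFactor θ c := Real.sqrt_nonneg _
  have hch := Real.one_le_cosh φ.re
  set s := Real.sin (θ - c) with hsdef
  set C := Real.cosh φ.re with hC
  have hexp : Real.exp ((contour θ μ φ).re * t) ≤
      Real.exp (μ * T) * Real.exp (-(μ * t₀ * s * C)) := by
    rw [← Real.exp_add]
    refine Real.exp_le_exp.2 ?_
    rw [contour_re]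
    have h1 : μ * t ≤ μ * T := mul_le_mul_of_nonneg_left htT hμ.le
    have h2 : t₀ * s ≤ t * Real.sin (θ + φ.im) :=
      mul_le_mul ht (H.sin_mem hφ).1 hs.le (ht₀.le.trans ht)
    have h3 : t₀ * s * (μ * C) ≤ t * Real.sin (θ + φ.im) * (μ * C) :=
      mul_le_mul_of_nonneg_right h2 (by positivity)
    linarith
  have ha : 0 ≤ μ * t₀ * s := by positivity
  have hd1 : Real.exp (-(μ * t₀ * s * C)) ≤ coshDecay (μ * t₀ * s) φ.re := by
    refine Real.exp_le_exp.2 ?_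
    rw [← hC]
    linarith
  have hd2 : Real.exp (-(μ * t₀ * s * C)) * (1 + μ * C) ≤
      (1 + 2 / (t₀ * s)) * coshDecay (μ * t₀ * s / 2) φ.re := by
    have h1 := one_add_mul_exp_neg_le (δ := t₀ * s / 2) (y := μ * C) (by positivity) (by positivity)
    have h2 : Real.exp (-(μ * t₀ * s * C)) =
        Real.exp (-(t₀ * s / 2 * (μ * C))) * Real.exp (-(μ * t₀ * s / 2 * C)) := by
      rw [← Real.exp_add]; ring_nf
    have h3 : Real.exp (-(μ * t₀ * s / 2 * C)) ≤ coshDecay (μ * t₀ * s / 2) φ.re := by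
      refine Real.exp_le_exp.2 ?_
      rw [← hC]
      linarith
    have h4 : 1 / (t₀ * s / 2) = 2 / (t₀ * s) := by field_simp
    rw [h4] at h1
    calc Real.exp (-(μ * t₀ * s * C)) * (1 + μ * C)
        = ((1 + μ * C) * Real.exp (-(t₀ * s / 2 * (μ * C)))) *
            Real.exp (-(μ * t₀ * s / 2 * C)) := by rw [h2]; ring
      _ ≤ _ := by gcongr
  rw [mul_assoc _ (Real.exp (μ * T))]
  refine mul_le_mul_of_nonneg_left ?_ (by positivity)
  calc Real.exp ((contour θ μ φ).re * t) * (‖u₀‖ + B * (1 + μ * C))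
      ≤ Real.exp (μ * T) * Real.exp (-(μ * t₀ * s * C)) * (‖u₀‖ + B * (1 + μ * C)) := by gcongr
    _ = Real.exp (μ * T) * (‖u₀‖ * Real.exp (-(μ * t₀ * s * C)) +
        B * (Real.exp (-(μ * t₀ * s * C)) * (1 + μ * C))) := by ring
    _ ≤ Real.exp (μ * T) * (‖u₀‖ * coshDecay (μ * t₀ * s) φ.re +
        B * ((1 + 2 / (t₀ * s)) * coshDecay (μ * t₀ * s / 2) φ.re)) := by gcongr
    _ = _ := by ring

/-- The integrand on the real axis beyond a point `P` with `sin (θ - c) cosh P ≥ 1`. The surplus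
`sin θ - sin (θ - c)` of decay absorbs the growth of the source contribution. -/
lemma norm_integrand_tail_le (u₀ : L2R Ω) {F : ℂ → L2C Ω} {B t₀ t P h : ℝ} (ht₀ : 0 < t₀)
    (ht : t₀ ≤ t) (hP : 0 ≤ P) (hP1 : 1 ≤ Real.sin (θ - c) * Real.cosh P) (hh : 0 ≤ h)
    (hB : ‖F (contour θ μ ((P + h : ℝ) : ℂ))‖ ≤ B) :
    ‖integrand Ω α β θ μ u₀ F t ((P + h : ℝ) : ℂ)‖ ≤
      (2 * Real.pi * sectorConst α β ε)⁻¹ * phiFactor θ c *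
      Real.exp (μ * t₀ * (1 - Real.sin (θ - c) * Real.cosh P)) *
      (‖u₀‖ + B * (1 + 1 / (t₀ * (Real.sin θ - Real.sin (θ - c))))) *
      coshDecay (μ * t₀ * Real.sin (θ - c)) h := by
  have hφ : ((P + h : ℝ) : ℂ) ∈ strip c := by simpa [strip] using H.c_pos
  refine (H.norm_integrand_le u₀ t hφ hB).trans ?_
  have hs := H.sin_sub_pos
  have hs' := H.sin_sub_lt_sin
  have hμ := H.μ_pos
  have hκ := H.sectorConst_pos
  have hpi := Real.pi_pos
  have hB0 : 0 ≤ B := (norm_nonneg _).trans hB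
  have hφ0 : 0 ≤ phiFactor θ c := Real.sqrt_nonneg _
  rw [contour_re, Complex.ofReal_re, Complex.ofReal_im, add_zero]
  set s := Real.sin (θ - c) with hsdef
  set δ := t₀ * (Real.sin θ - s) with hδ
  have hδ0 : 0 < δ := mul_pos ht₀ (by linarith)
  set C := Real.cosh (P + h) with hC
  have hC1 : 1 ≤ C := Real.one_le_cosh _
  have hCP : Real.cosh P + (Real.cosh h - 1) ≤ C := by
    rw [hC, Real.cosh_add]
    nlinarith [Real.one_le_cosh P, Real.one_le_cosh h,
      mul_nonneg (Real.sinh_nonneg_iff.2 hP) (Real.sinh_nonneg_iff.2 hh)]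
  have hexp : Real.exp (μ * (1 - Real.sin θ * C) * t) ≤
      Real.exp (μ * t₀ * (1 - s * Real.cosh P)) * coshDecay (μ * t₀ * s) h *
        Real.exp (-(δ * (μ * C))) := by
    rw [coshDecay, ← Real.exp_add, ← Real.exp_add]
    refine Real.exp_le_exp.2 ?_
    have h0 : Real.cosh P ≤ C := by linarith [Real.one_le_cosh h]
    have h1 : 0 ≤ s * C - 1 := by nlinarith
    have h2 : (t - t₀) * μ * (s * C - 1) ≥ 0 :=
      mul_nonneg (mul_nonneg (by linarith) hμ.le) h1
    have h3 : (t - t₀) * (Real.sin θ - s) * (μ * C) ≥ 0 :=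
      mul_nonneg (mul_nonneg (by linarith) (by linarith)) (by positivity)
    have h4 : 0 ≤ μ * t₀ * s * (C - (Real.cosh P + (Real.cosh h - 1))) :=
      mul_nonneg (by positivity) (by linarith)
    rw [hδ]
    nlinarith
  have hd := one_add_mul_exp_neg_le hδ0 (show 0 ≤ μ * C by positivity)
  have hd1 : Real.exp (-(δ * (μ * C))) ≤ 1 := by
    rw [Real.exp_le_one_iff, neg_nonpos]; positivity
  have hcd := coshDecay_pos (μ * t₀ * s) h
  have hK : 0 ≤ (2 * Real.pi * sectorConst α β ε)⁻¹ * phiFactor θ c := by positivity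
  have hmain : Real.exp (μ * (1 - Real.sin θ * C) * t) * (‖u₀‖ + B * (1 + μ * C)) ≤
      Real.exp (μ * t₀ * (1 - s * Real.cosh P)) *
        ((‖u₀‖ + B * (1 + 1 / δ)) * coshDecay (μ * t₀ * s) h) := by
    calc Real.exp (μ * (1 - Real.sin θ * C) * t) * (‖u₀‖ + B * (1 + μ * C))
        ≤ Real.exp (μ * t₀ * (1 - s * Real.cosh P)) * coshDecay (μ * t₀ * s) h *
          Real.exp (-(δ * (μ * C))) * (‖u₀‖ + B * (1 + μ * C)) := by gcongr
      _ = Real.exp (μ * t₀ * (1 - s * Real.cosh P)) * coshDecay (μ * t₀ * s) h *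
          (‖u₀‖ * Real.exp (-(δ * (μ * C))) + B * ((1 + μ * C) * Real.exp (-(δ * (μ * C))))) := by
          ring
      _ ≤ Real.exp (μ * t₀ * (1 - s * Real.cosh P)) * coshDecay (μ * t₀ * s) h *
          (‖u₀‖ * 1 + B * (1 + 1 / δ)) := by gcongr
      _ = Real.exp (μ * t₀ * (1 - s * Real.cosh P)) * ((‖u₀‖ + B * (1 + 1 / δ)) *
          coshDecay (μ * t₀ * s) h) := by ring
  exact (mul_le_mul_of_nonneg_left hmain hK).trans_eq (by ring)

lemma integrand_neg (u₀ : L2R Ω) {F : ℂ → L2C Ω} (t : ℝ)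
    (hF : ∀ φ ∈ strip c, F (conj (contour θ μ φ)) = conjL2 Ω (F (contour θ μ φ))) (x : ℝ) :
    integrand Ω α β θ μ u₀ F t ((-x : ℝ) : ℂ) =
      conjL2 Ω (integrand Ω α β θ μ u₀ F t (x : ℂ)) := by
  have hφ : (x : ℂ) ∈ strip c := by simpa [strip] using H.c_pos
  have hsl := H.contour_mem_slitPlane hφ
  have hu : uHat Ω α β u₀ F (conj (contour θ μ x)) =
      conjL2 Ω (uHat Ω α β u₀ F (contour θ μ x)) := by
    unfold uHat
    rw [conjL2_resolvent (H.mFun_mem_slitPlane hφ), map_add, (conjL2 Ω).map_smulₛₗ,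
      (conjL2 Ω).map_smulₛₗ, conjL2_toC, hF _ hφ, mFun_conj hsl, map_div₀, map_div₀,
      Complex.conj_cpow _ _ (Complex.mem_slitPlane_iff_arg.1 hsl).1, Complex.conj_ofReal]
  unfold integrand
  rw [contour_neg_ofReal, deriv_contour_neg_ofReal, hu, (conjL2 Ω).map_smulₛₗ]
  congr 1
  simp only [map_mul, map_inv₀, ← Complex.exp_conj, Complex.conj_ofReal, Complex.conj_I, map_ofNat]
  rw [mul_neg, mul_neg, inv_neg]
  ring

end Admissible

end Integrand

/-! ### The error estimate -/

section ErrorEstimate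

variable {α β ε θ c μ : ℝ} {n : ℕ} {Ω : Set (E n)}

/-- The scheme is the symmetric partial sum of the midpoint rule: the terms with negative index are
the conjugates of those with nonnegative index. -/
lemma toC_cimSol (u₀ : L2R Ω) (F : ℂ → L2C Ω) (t τ : ℝ) (N : ℕ) :
    toC (cimSol Ω α β θ μ τ N u₀ F t) = (τ : ℂ) • ∑ k ∈ Finset.range N,
      (integrand Ω α β θ μ u₀ F t (node τ k) +
        conjL2 Ω (integrand Ω α β θ μ u₀ F t (node τ k))) := by
  have hpi : (Real.pi : ℂ) ≠ 0 := by exact_mod_cast Real.pi_ne_zero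
  have hterm : ∀ k, (Complex.exp (contour θ μ (node τ k) * t) *
      deriv (contour θ μ) (node τ k)) • uHat Ω α β u₀ F (contour θ μ (node τ k)) =
      (2 * Real.pi * Complex.I : ℂ) • integrand Ω α β θ μ u₀ F t (node τ k) := by
    intro k
    rw [integrand, smul_smul]
    congr 1
    have := Complex.I_ne_zero
    field_simp
  unfold cimSol
  simp only [hterm]
  rw [toC_smul_imPart, ← Finset.smul_sum, (conjL2 Ω).map_smulₛₗ, map_sum, Finset.sum_add_distrib]
  have h2 : (starRingEnd ℂ) (2 * Real.pi * Complex.I : ℂ) = -(2 * Real.pi * Complex.I) := by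
    rw [map_mul, map_mul, map_ofNat, Complex.conj_ofReal, Complex.conj_I, mul_neg]
  rw [h2, neg_smul, sub_neg_eq_add, ← smul_add, smul_smul]
  congr 1
  push_cast
  have := Complex.I_ne_zero
  field_simp

lemma norm_smul_sub_smul_sum_le {H : Type*} [NormedAddCommGroup H] [NormedSpace ℂ H] {p : ℕ → H}
    {S : H} (hp : HasSum p S) (r : ℂ) (N : ℕ) {b : ℕ → ℝ} {M : ℝ}
    (hb : ∀ j, ‖r • p (j + N)‖ ≤ b j) (hM : ∀ m, ∑ j ∈ Finset.range m, b j ≤ M) :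
    ‖r • S - r • ∑ k ∈ Finset.range N, p k‖ ≤ M := by
  have h1 : HasSum (fun j => p (j + N)) (S - ∑ k ∈ Finset.range N, p k) :=
    (hasSum_nat_add_iff' N).2 hp
  rw [← smul_sub]
  exact le_of_tendsto (h1.const_smul r).tendsto_sum_nat.norm
    (Filter.Eventually.of_forall fun m => (norm_sum_le_of_le _ fun j _ => hb j).trans (hM m))

/-- The midpoint rule over all of `ℝ`, applied to the integrand. -/
lemma Admissible.quadrature_error_le (H : Admissible α β ε θ c μ) (u₀ : L2R Ω) {F : ℂ → L2C Ω}
    {B t₀ t T τ : ℝ} (ht₀ : 0 < t₀) (ht : t₀ ≤ t) (htT : t ≤ T) (hτ : 0 < τ)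
    (hFd : ∀ φ ∈ strip c, DifferentiableAt ℂ F (contour θ μ φ))
    (hFB : ∀ φ ∈ strip c, ‖F (contour θ μ φ)‖ ≤ B) :
    Integrable (fun φ : ℝ => integrand Ω α β θ μ u₀ F t φ) ∧
    (Summable fun k : ℤ => integrand Ω α β θ μ u₀ F t (((1 / 2 + k) * τ : ℝ))) ∧
    ‖exactSol Ω α β θ μ u₀ F t -
        (τ : ℂ) • ∑' k : ℤ, integrand Ω α β θ μ u₀ F t (((1 / 2 + k) * τ : ℝ))‖ ≤
      (2 * Real.pi * sectorConst α β ε)⁻¹ * phiFactor θ c *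
        (24 * ‖u₀‖ + 48 * (1 + 2 / (t₀ * Real.sin (θ - c))) * B) *
        LFun (μ * t₀ * Real.sin (θ - c)) *
        (Real.exp (μ * T) / (Real.exp (2 * Real.pi * c / τ) - 1)) := by
  have hs := H.sin_sub_pos
  have hμ := H.μ_pos
  have hκ := H.sectorConst_pos
  have hpi := Real.pi_pos
  have hφ0 : 0 ≤ phiFactor θ c := Real.sqrt_nonneg _
  have hreal : ∀ x : ℝ, (x : ℂ) ∈ strip c := fun x => by simpa [strip] using H.c_pos
  have hB0 : 0 ≤ B := (norm_nonneg _).trans (hFB 0 (by simpa using hreal 0))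
  set s := Real.sin (θ - c) with hsdef
  set a := μ * t₀ * s with hadef
  have ha : 0 < a := by positivity
  set A := (2 * Real.pi * sectorConst α β ε)⁻¹ * phiFactor θ c with hA
  have hA0 : 0 ≤ A := by positivity
  set b₁ := 1 + 2 / (t₀ * s) with hb₁
  have hb₁0 : 0 ≤ b₁ := by positivity
  set g : ℂ → L2C Ω := integrand Ω α β θ μ u₀ F t with hg
  set G : ℝ → ℝ := fun x => A * Real.exp (μ * T) *
    (‖u₀‖ * coshDecay a x + B * b₁ * coshDecay (a / 2) x) with hG
  have hgG : ∀ w ∈ strip c, ‖g w‖ ≤ G w.re := fun w hw =>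
    H.norm_integrand_le_coshDecay u₀ ht₀ ht htT hw (hFB w hw)
  have hgd : DifferentiableOn ℂ g (strip c) := H.differentiableOn_integrand u₀ t hFd
  have hGi : Integrable G := (((integrable_coshDecay ha).const_mul _).add
    ((integrable_coshDecay (half_pos ha)).const_mul _)).const_mul _
  have hgi : Integrable fun x : ℝ => g x := by
    refine hGi.mono' ?_ (Filter.Eventually.of_forall fun x => by simpa using hgG x (hreal x))
    exact (hgd.continuousOn.comp_continuous Complex.continuous_ofReal hreal).aestronglyMeasurable
  have hGs : Summable fun k : ℤ => G ((1 / 2 + k) * τ) :=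
    (((summable_coshDecay ha hτ).mul_left _).add
      ((summable_coshDecay (half_pos ha) hτ).mul_left _)).mul_left _
  have hGK : ∀ x, x ^ 2 * G x ≤
      A * Real.exp (μ * T) * (‖u₀‖ * (2 / a) + B * b₁ * (2 / (a / 2))) := by
    intro x
    calc x ^ 2 * G x = A * Real.exp (μ * T) * (‖u₀‖ * (x ^ 2 * coshDecay a x) +
          B * b₁ * (x ^ 2 * coshDecay (a / 2) x)) := by rw [hG]; ring
      _ ≤ _ := by
          have h1 := sq_mul_coshDecay_le ha x
          have h2 := sq_mul_coshDecay_le (half_pos ha) x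
          gcongr
  have hquad := norm_integral_sub_smul_tsum_le H.c_pos hτ hgd hgG hGK hGi hGs
  set L := LFun a with hL
  have hGint : ∫ x, G x ≤ A * Real.exp (μ * T) * (‖u₀‖ * (12 * L) + B * b₁ * (24 * L)) := by
    have h1 := integral_coshDecay_le ha
    have h2 := (integral_coshDecay_le (half_pos ha)).trans
      (mul_le_mul_of_nonneg_left (LFun_half_le ha) (by norm_num : (0 : ℝ) ≤ 12))
    have h3 : ∫ x, G x = A * Real.exp (μ * T) *
        (‖u₀‖ * (∫ x, coshDecay a x) + B * b₁ * ∫ x, coshDecay (a / 2) x) := by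
      rw [hG, integral_const_mul, integral_add ((integrable_coshDecay ha).const_mul _)
        ((integrable_coshDecay (half_pos ha)).const_mul _), integral_const_mul, integral_const_mul]
    rw [h3]
    have h4 : ∫ x, coshDecay (a / 2) x ≤ 24 * L := by linarith
    gcongr
  have hden : 0 < Real.exp (2 * Real.pi * c / τ) - 1 := by
    rw [sub_pos, Real.one_lt_exp_iff]
    have := H.c_pos
    positivity
  have hgs : Summable fun k : ℤ => g (((1 / 2 + k) * τ : ℝ)) :=
    Summable.of_norm_bounded hGs fun k => by simpa using hgG _ (hreal ((1 / 2 + k) * τ))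
  refine ⟨hgi, hgs, hquad.trans ?_⟩
  calc 2 * (∫ x, G x) / (Real.exp (2 * Real.pi * c / τ) - 1)
      ≤ 2 * (A * Real.exp (μ * T) * (‖u₀‖ * (12 * L) + B * b₁ * (24 * L))) /
        (Real.exp (2 * Real.pi * c / τ) - 1) := by gcongr
    _ = _ := by ring

/-- The truncation of the midpoint rule to `|x| < P = N τ`. -/
lemma Admissible.truncation_error_le (H : Admissible α β ε θ c μ) (u₀ : L2R Ω) {F : ℂ → L2C Ω}
    {B t₀ t τ P : ℝ} {N : ℕ} (ht₀ : 0 < t₀) (ht : t₀ ≤ t) (hτ : 0 < τ)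
    (hP : 0 ≤ P) (hNτ : N * τ = P) (hP1 : 1 ≤ Real.sin (θ - c) * Real.cosh P)
    (hFc : ∀ φ ∈ strip c, F (conj (contour θ μ φ)) = conjL2 Ω (F (contour θ μ φ)))
    (hFB : ∀ φ ∈ strip c, ‖F (contour θ μ φ)‖ ≤ B)
    (hgs : Summable fun k : ℤ => integrand Ω α β θ μ u₀ F t (((1 / 2 + k) * τ : ℝ))) :
    ‖(τ : ℂ) • (∑' k : ℤ, integrand Ω α β θ μ u₀ F t (((1 / 2 + k) * τ : ℝ))) -
        toC (cimSol Ω α β θ μ τ N u₀ F t)‖ ≤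
      (2 * Real.pi * sectorConst α β ε)⁻¹ * phiFactor θ c *
        (48 * ‖u₀‖ + 48 * (1 + 1 / (t₀ * (Real.sin θ - Real.sin (θ - c)))) * B) *
        LFun (μ * t₀ * Real.sin (θ - c)) *
        Real.exp (μ * t₀ * (1 - Real.sin (θ - c) * Real.cosh P)) := by
  have hs := H.sin_sub_pos
  have hs' := H.sin_sub_lt_sin
  have hκ := H.sectorConst_pos
  have hpi := Real.pi_pos
  have hφ0 : 0 ≤ phiFactor θ c := Real.sqrt_nonneg _
  have hreal : ∀ x : ℝ, (x : ℂ) ∈ strip c := fun x => by simpa [strip] using H.c_pos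
  have hB0 : 0 ≤ B := (norm_nonneg _).trans (hFB 0 (by simpa using hreal 0))
  set s := Real.sin (θ - c) with hsdef
  set a := μ * t₀ * s with hadef
  have ha : 0 < a := mul_pos (mul_pos H.μ_pos ht₀) hs
  set A := (2 * Real.pi * sectorConst α β ε)⁻¹ * phiFactor θ c with hA
  have hA0 : 0 ≤ A := by positivity
  set b := 1 + 1 / (t₀ * (Real.sin θ - s)) with hb
  have hb0 : 0 ≤ b := by
    have : 0 < t₀ * (Real.sin θ - s) := mul_pos ht₀ (by linarith)
    positivity
  set Q := Real.exp (μ * t₀ * (1 - s * Real.cosh P)) with hQ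
  have hQ0 : 0 ≤ Q := (Real.exp_pos _).le
  set g : ℂ → L2C Ω := integrand Ω α β θ μ u₀ F t with hg
  -- regroup the bilateral sum into pairs of conjugate terms
  set p : ℕ → L2C Ω := fun k => g (node τ k) + conjL2 Ω (g (node τ k)) with hp
  have hpsum : HasSum p (∑' k : ℤ, g (((1 / 2 + k) * τ : ℝ))) := by
    convert! hgs.hasSum.nat_add_neg_add_one using 1
    funext k
    have e1 : (1 / 2 + ((k : ℤ) : ℝ)) * τ = node τ k := by rw [node]; push_cast; ring
    have e2 : (1 / 2 + ((-((k : ℤ) + 1) : ℤ) : ℝ)) * τ = -node τ k := by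
      rw [node]; push_cast; ring
    rw [e1, e2, hg, H.integrand_neg u₀ t hFc]
  have htail : ∀ j : ℕ, ‖(τ : ℂ) • p (j + N)‖ ≤
      A * Q * (‖u₀‖ + B * b) * (2 * (τ * coshDecay a ((j + 1 / 2) * τ))) := by
    intro j
    have e1 : node τ (j + N) = P + (j + 1 / 2) * τ := by
      rw [node, ← hNτ]; push_cast; ring
    have h1 := H.norm_integrand_tail_le u₀ (h := (j + 1 / 2) * τ) ht₀ ht hP hP1 (by positivity)
      (hFB _ (hreal _))
    have h2 : ‖p (j + N)‖ ≤ 2 * ‖g (node τ (j + N))‖ := by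
      rw [hp]
      refine (norm_add_le _ _).trans ?_
      rw [norm_conjL2, two_mul]
    rw [norm_smul, Complex.norm_real, Real.norm_of_nonneg hτ.le]
    rw [← e1] at h1
    have hcd := coshDecay_pos a ((j + 1 / 2) * τ)
    calc τ * ‖p (j + N)‖
        ≤ τ * (2 * (A * Q * (‖u₀‖ + B * b) * coshDecay a ((j + 1 / 2) * τ))) := by
          gcongr
          exact h2.trans (mul_le_mul_of_nonneg_left h1 (by norm_num))
      _ = _ := by ring
  rw [toC_cimSol]
  refine norm_smul_sub_smul_sum_le hpsum (τ : ℂ) N htail fun m => ?_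
  rw [← Finset.mul_sum, ← Finset.mul_sum]
  have h3 := sum_coshDecay_le_LFun ha hτ m
  calc A * Q * (‖u₀‖ + B * b) * (2 * ∑ j ∈ Finset.range m, τ * coshDecay a ((j + 1 / 2) * τ))
      ≤ A * Q * (‖u₀‖ + B * b) * (2 * (24 * LFun a)) := by gcongr
    _ = _ := by ring

/-- The error bound for an abstract source: the quadrature error on the strip plus the truncation
error beyond `P = N τ`, both controlled by the same factor `Q`. -/
lemma Admissible.error_le (H : Admissible α β ε θ c μ) (u₀ : L2R Ω) {F : ℂ → L2C Ω}
    {B t₀ t T τ P Q : ℝ} {N : ℕ} (ht₀ : 0 < t₀) (ht : t₀ ≤ t) (htT : t ≤ T) (hτ : 0 < τ)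
    (hP : 0 ≤ P) (hNτ : N * τ = P) (hP1 : 1 ≤ Real.sin (θ - c) * Real.cosh P)
    (hFd : ∀ φ ∈ strip c, DifferentiableAt ℂ F (contour θ μ φ))
    (hFc : ∀ φ ∈ strip c, F (conj (contour θ μ φ)) = conjL2 Ω (F (contour θ μ φ)))
    (hFB : ∀ φ ∈ strip c, ‖F (contour θ μ φ)‖ ≤ B)
    (hQ : Q = Real.exp (μ * T) / (Real.exp (2 * Real.pi * c / τ) - 1))
    (hPQ : Real.exp (μ * t₀ * (1 - Real.sin (θ - c) * Real.cosh P)) ≤ Q) :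
    Integrable (fun φ : ℝ => integrand Ω α β θ μ u₀ F t φ) ∧
    ‖exactSol Ω α β θ μ u₀ F t - toC (cimSol Ω α β θ μ τ N u₀ F t)‖ ≤
      (2 * Real.pi * sectorConst α β ε)⁻¹ * phiFactor θ c *
        LFun (μ * t₀ * Real.sin (θ - c)) *
        (72 * ‖u₀‖ + 48 * (2 + 2 / (t₀ * Real.sin (θ - c)) +
          1 / (t₀ * (Real.sin θ - Real.sin (θ - c)))) * B) * Q := by
  obtain ⟨hint, hsum, hE1⟩ := H.quadrature_error_le u₀ ht₀ ht htT hτ hFd hFB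
  have hE2 := H.truncation_error_le u₀ ht₀ ht hτ hP hNτ hP1 hFc hFB hsum
  have hs := H.sin_sub_pos
  have hd : 0 < t₀ * (Real.sin θ - Real.sin (θ - c)) :=
    mul_pos ht₀ (by linarith [H.sin_sub_lt_sin])
  have hκ := H.sectorConst_pos
  have hpi := Real.pi_pos
  have hφ0 : 0 ≤ phiFactor θ c := Real.sqrt_nonneg _
  have hL0 : 0 ≤ LFun (μ * t₀ * Real.sin (θ - c)) := zero_le_one.trans (one_le_LFun _)
  have hB0 : 0 ≤ B :=
    (norm_nonneg _).trans (hFB 0 (by simpa [strip] using H.c_pos))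
  have hE2' := hE2.trans (mul_le_mul_of_nonneg_left hPQ (by positivity))
  rw [← hQ] at hE1
  exact ⟨hint, (norm_sub_le_norm_sub_add_norm_sub _ _ _).trans
    ((add_le_add hE1 hE2').trans_eq (by ring))⟩

/-- With `cosh P = Λ / ((1 - η) sin (θ - c))` the truncation point is chosen so that both errors
balance: `μ t₀ sin (θ - c) cosh P = 2 π c / τ`. -/
lemma error_factors {t₀ Λ η : ℝ} {N : ℕ} (hs : 0 < Real.sin (θ - c))
    (hs1 : Real.sin (θ - c) < 1) (hc : 0 < c) (ht₀ : 0 < t₀) (hΛ : 1 ≤ Λ) (hη₀ : 0 < η)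
    (hη₁ : η < 1) (hN : 1 ≤ N) :
    0 < PFun θ c Λ η ∧ 0 < muParam θ c t₀ Λ η N ∧ 0 < tauParam θ c Λ η N ∧
      1 ≤ Real.sin (θ - c) * Real.cosh (PFun θ c Λ η) ∧
      Real.exp (muParam θ c t₀ Λ η N * t₀ *
          (1 - Real.sin (θ - c) * Real.cosh (PFun θ c Λ η))) ≤
        Real.exp (muParam θ c t₀ Λ η N * (Λ * t₀)) /
          (Real.exp (2 * Real.pi * c / tauParam θ c Λ η N) - 1) := by
  have hpi := Real.pi_pos
  have hη : 0 < 1 - η := by linarith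
  have hΛ0 : 0 < Λ := by linarith
  have hden : 0 < (1 - η) * Real.sin (θ - c) := mul_pos hη hs
  have harg : 1 < Λ / ((1 - η) * Real.sin (θ - c)) := by
    rw [one_lt_div hden]
    nlinarith
  have hP : 0 < PFun θ c Λ η := Real.arcosh_pos harg
  have hN0 : (0 : ℝ) < N := by exact_mod_cast hN
  have hμ : 0 < muParam θ c t₀ Λ η N := by unfold muParam; positivity
  have hτ : 0 < tauParam θ c Λ η N := div_pos hP hN0
  have hcosh : Real.sin (θ - c) * Real.cosh (PFun θ c Λ η) = Λ / (1 - η) := by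
    rw [PFun, Real.cosh_arcosh harg.le]
    field_simp
  have h1 : 1 ≤ Λ / (1 - η) := by rw [one_le_div hη]; linarith
  refine ⟨hP, hμ, hτ, hcosh ▸ h1, ?_⟩
  have hexp : 2 * Real.pi * c / tauParam θ c Λ η N =
      muParam θ c t₀ Λ η N * t₀ * (Λ / (1 - η)) := by
    unfold tauParam muParam
    field_simp
  have hpos : 0 < 2 * Real.pi * c / tauParam θ c Λ η N := by positivity
  rw [hcosh, le_div_iff₀ (by rw [sub_pos, Real.one_lt_exp_iff]; exact hpos), hexp]
  calc Real.exp (muParam θ c t₀ Λ η N * t₀ * (1 - Λ / (1 - η))) *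
        (Real.exp (muParam θ c t₀ Λ η N * t₀ * (Λ / (1 - η))) - 1)
      ≤ Real.exp (muParam θ c t₀ Λ η N * t₀ * (1 - Λ / (1 - η))) *
        Real.exp (muParam θ c t₀ Λ η N * t₀ * (Λ / (1 - η))) := by gcongr; linarith
    _ = Real.exp (muParam θ c t₀ Λ η N * t₀ * 1) := by rw [← Real.exp_add]; ring_nf
    _ ≤ Real.exp (muParam θ c t₀ Λ η N * (Λ * t₀)) := by
        refine Real.exp_le_exp.2 ?_
        rw [mul_one]
        exact mul_le_mul_of_nonneg_left (le_mul_of_one_le_left ht₀.le hΛ) hμ.le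

end ErrorEstimate

end CIM

end

theorem theorem2 (α β ε : ℝ) (hα₀ : 0 < α) (hα₁ : α < 1) (hβ₀ : 0 < β) (hβ₁ : β < 1)
    (hε₀ : 0 < ε) (hε₁ : ε < 1) (hlow : ε < α + β) (hupp : α + β < 2 - ε) :
    -- `C₀` depends on `α, β, ε` only
    ∃ C₀ : ℝ, 0 < C₀ ∧
      ∀ θ c t₀ : ℝ, 0 < c → c < θ → θ + c ≤ ε * Real.pi / (2 * (α + β)) → 0 < t₀ →
        -- `C` may depend on `θ, c, t₀` in addition
        ∃ C : ℝ, 0 < C ∧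
          ∀ (n : ℕ) (Ω : Set (CIM.E n)), IsOpen Ω → Bornology.IsBounded Ω → Convex ℝ Ω →
          ∀ (Λ η : ℝ) (N : ℕ), 1 ≤ Λ → 0 < η → η < 1 → 1 ≤ N →
          ∀ μ τ : ℝ, μ = CIM.muParam θ c t₀ Λ η N → τ = CIM.tauParam θ c Λ η N →
          ∀ (u₀ : CIM.L2R Ω) (t : ℝ), t ∈ Set.Icc t₀ (Λ * t₀) →
            -- general source term
            (∀ (f : ℝ → CIM.L2R Ω) (F : ℂ → CIM.L2C Ω),
              CIM.IsSourceTransform f F (CIM.region θ μ c) →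
              BddAbove ((fun z => ‖F z‖) '' CIM.region θ μ c) →
              MeasureTheory.Integrable
                (fun φ : ℝ => CIM.integrand Ω α β θ μ u₀ F t φ) ∧
              ‖CIM.exactSol Ω α β θ μ u₀ F t - CIM.toC (CIM.cimSol Ω α β θ μ τ N u₀ F t)‖ ≤
                C * CIM.phiFactor θ c * CIM.LFun (μ * t₀ * Real.sin (θ - c)) *
                  (‖u₀‖ + CIM.supNorm F (CIM.region θ μ c)) *
                  (Real.exp (μ * Λ * t₀) / (Real.exp (2 * Real.pi * c / τ) - 1))) ∧
            -- zero source term: the constant is `C₀`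
            ‖CIM.exactSol Ω α β θ μ u₀ 0 t - CIM.toC (CIM.cimSol Ω α β θ μ τ N u₀ 0 t)‖ ≤
              C₀ * CIM.phiFactor θ c * CIM.LFun (μ * t₀ * Real.sin (θ - c)) * ‖u₀‖ *
                (Real.exp (μ * Λ * t₀) / (Real.exp (2 * Real.pi * c / τ) - 1)) := by
  have hpi := Real.pi_pos
  have hab : 0 < α + β := by linarith
  have hκ : 0 < CIM.sectorConst α β ε := by
    refine Real.cos_pos_of_mem_Ioo ⟨?_, ?_⟩ <;> nlinarith
  have hK : 0 < (2 * Real.pi * CIM.sectorConst α β ε)⁻¹ := by positivity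
  refine ⟨72 * (2 * Real.pi * CIM.sectorConst α β ε)⁻¹, by positivity, ?_⟩
  intro θ c t₀ hc hcθ hθc ht₀
  have hangle : (α + β) * (θ + c) ≤ ε * Real.pi / 2 := by
    rw [le_div_iff₀ (by positivity)] at hθc
    linarith
  have hlt : θ + c < Real.pi / 2 := by nlinarith
  have hs : 0 < Real.sin (θ - c) := Real.sin_pos_of_pos_of_lt_pi (by linarith) (by linarith)
  have hs' : Real.sin (θ - c) < Real.sin θ :=
    Real.sin_lt_sin_of_lt_of_le_pi_div_two (by linarith) (by linarith) (by linarith)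
  have hs1 : Real.sin (θ - c) < 1 := hs'.trans_le (Real.sin_le_one θ)
  have hd : 0 < t₀ * (Real.sin θ - Real.sin (θ - c)) := mul_pos ht₀ (by linarith)
  set b : ℝ := 48 * (2 + 2 / (t₀ * Real.sin (θ - c)) +
    1 / (t₀ * (Real.sin θ - Real.sin (θ - c)))) with hb
  have hb0 : 0 < b := by positivity
  refine ⟨(72 + b) * (2 * Real.pi * CIM.sectorConst α β ε)⁻¹, by positivity, ?_⟩
  intro n Ω _ _ _ Λ η N hΛ hη₀ hη₁ hN μ τ hμ hτ u₀ t ht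
  obtain ⟨hP, hμ0, hτ0, hP1, hPQ⟩ :=
    CIM.error_factors (N := N) hs hs1 hc ht₀ hΛ hη₀ hη₁ hN
  rw [← hμ] at hμ0 hPQ
  rw [← hτ] at hτ0 hPQ
  have hNτ : N * τ = CIM.PFun θ c Λ η := by
    have : (0 : ℝ) < N := by exact_mod_cast hN
    rw [hτ, CIM.tauParam]
    field_simp
  have H : CIM.Admissible α β ε θ c μ :=
    ⟨hα₀, hβ₀, hβ₁.le, by linarith, hc, hcθ, hlt, hangle, hμ0⟩
  have hQ : Real.exp (μ * Λ * t₀) / (Real.exp (2 * Real.pi * c / τ) - 1) =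
      Real.exp (μ * (Λ * t₀)) / (Real.exp (2 * Real.pi * c / τ) - 1) := by rw [mul_assoc μ]
  rw [hQ]
  set Q := Real.exp (μ * (Λ * t₀)) / (Real.exp (2 * Real.pi * c / τ) - 1) with hQdef
  have hQ0 : 0 ≤ Q := (Real.exp_pos _).le.trans hPQ
  have hφ0 : 0 ≤ CIM.phiFactor θ c := Real.sqrt_nonneg _
  have hL0 : 0 ≤ CIM.LFun (μ * t₀ * Real.sin (θ - c)) :=
    zero_le_one.trans (CIM.one_le_LFun _)
  constructor
  · intro f F hfF hbdd
    have hmem : ∀ φ ∈ CIM.strip c, CIM.contour θ μ φ ∈ CIM.region θ μ c :=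
      fun φ hφ => Set.mem_image_of_mem _ hφ
    have hFB : ∀ φ ∈ CIM.strip c,
        ‖F (CIM.contour θ μ φ)‖ ≤ CIM.supNorm F (CIM.region θ μ c) :=
      fun φ hφ => le_csSup hbdd (Set.mem_image_of_mem _ (hmem φ hφ))
    have hB0 : 0 ≤ CIM.supNorm F (CIM.region θ μ c) :=
      (norm_nonneg _).trans (hFB 0 (by simpa [CIM.strip] using hc))
    have hFd : ∀ φ ∈ CIM.strip c, DifferentiableAt ℂ F (CIM.contour θ μ φ) := by
      obtain ⟨D, σ, hDo, -, -, hSD, -, hF, -⟩ := hfF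
      exact fun φ hφ => hF.differentiableAt (hDo.mem_nhds (hSD (hmem φ hφ)))
    obtain ⟨hint, herr⟩ := H.error_le u₀ ht₀ ht.1 ht.2 hτ0 hP.le hNτ hP1 hFd
      (fun φ hφ => hfF.conj_apply _ (hmem φ hφ)) hFB hQdef hPQ
    refine ⟨hint, herr.trans ?_⟩
    rw [← hb]
    set B := CIM.supNorm F (CIM.region θ μ c) with hB
    have hsum : 72 * ‖u₀‖ + b * B ≤ (72 + b) * (‖u₀‖ + B) := by
      nlinarith [mul_nonneg hb0.le (norm_nonneg u₀)]
    calc _ ≤ (2 * Real.pi * CIM.sectorConst α β ε)⁻¹ * CIM.phiFactor θ c *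
          CIM.LFun (μ * t₀ * Real.sin (θ - c)) * ((72 + b) * (‖u₀‖ + B)) * Q := by gcongr
      _ = _ := by ring
  · obtain ⟨-, herr⟩ := H.error_le u₀ (F := 0) (B := 0) ht₀ ht.1 ht.2 hτ0 hP.le hNτ hP1
      (fun φ _ => differentiableAt_const 0) (fun φ _ => by simp) (fun φ _ => by simp) hQdef hPQ
    refine herr.trans_eq ?_
    ring
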